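/- **Setting.** Let $\Omega\subset\mathbb R^\nu$ be open, $\lambda>0$, and let $g:\Omega\times[0,1]\to\mathbb R^\nu$, $f:\Omega\times[0,1]\to\mathbb R$ satisfy, with positive constants $L_g,M_g,L_f,M_f$ and for all $x,\bar x\in\Omega$, $a,\bar a\in[0,1]$ (Euclidean norm), $$\|g(x,a)-g(\bar x,\bar a)\|\le L_g(\|x-\bar x\|+|a-\bar a|),\quad \|g(x,a)\|\le M_g,$$ $$|f(x,a)-f(\bar x,\bar a)|\le L_f(\|x-\bar x\|+|a-\bar a|),\quad |f(x,a)|\le M_f.$$ For $a\in[0,1]$ let $\mathcal A(a)$ be the set of non-decreasing $\alpha:[0,\infty)\to[0,1]$ with $\alpha(0)\ge a$. Assume that for all $x\in\Omega$ and $\alpha\in\mathcal A(0)$ the system $\dot y=g(y,\alpha)$, $y(0)=x$ (in integrated form) has a solution on $[0,\infty)$ that stays in $\Omega$, and put $$u(x,a)=\inf_{\alpha\in\mathcal A(a)}\int_0^\infty f(y(s),\alpha(s))e^{-\lambda s}\,ds .$$ **Discretization.** For $h>0$ with $1/h$ an integer let $I_h=\{ih: i=0,\dots,1/h\}$ and $I_h(a)=I_h\cap[a,1]$.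 For $k$ in a set $\mathcal K\subset(0,\infty)$ let a finite conforming triangulation be given, with $\nu$-dimensional simplices $S^k_j$, union $\Omega_k=\bigcup_jS_j^k$ and set of vertices $V^k$, such that, with constants $\chi_1>0$ and $C$ independent of $k$: 1. $\max_j\operatorname{diam}S^k_j=k$; 2. there is $h_0=h_0(k)>0$ with $x+hg(x,a)\in\Omega_k$ for all $x\in\Omega_k$, $a\in I_h$, $h<h_0$; 3. $\Omega_k\subset\Omega$, and every compact $K\subset\Omega$ is contained in $\Omega_k$ for all $k\in\mathcal K$ below some $\bar k(K)>0$; 4. every simplex, with $d$ its diameter, has in its interior a ball of some radius $r>0$ with $r\le\chi_1 d$ (this holds in particular whenever there is such a ball with $r\ge\chi_1 d$); 5. $k/d\le C$ for the diameter $d$ of every simplex $S_j^k$. Let $W_k$ be the set of $w:\Omega_k\times I_h\to\mathbb R$ such that every $w(\cdot,a)$ is continuous on $\Omega_k$ with constant gradient in the interior of each simplex. The operator $A_k^h:W_k\to W_k$ is given by the nodal values $$(A_k^hw)(x,a)=\min_{b\in I_h(a)}\{(1-\lambda h)\,w(x+hg(x,a),b)+hf(x,a)\},\qquad x\in V^k,\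 a\in I_h .$$ **Theorem 3.1.** Let $\gamma=1$ if $L_g<\lambda$, $\gamma=\lambda/L_g$ if $L_g>\lambda$, and let $\gamma$ be any number in $(0,1)$ if $L_g=\lambda$. There is a constant $M$, depending only on $\gamma$, on $\chi_1$ and $C$, and on the data $\Omega,g,f,\lambda,L_g,M_g,L_f,M_f$, but not on $h$, $k$ or the triangulations, such that for every $k\in\mathcal K$ and every $h>0$ with $1/h$ an integer, $h<h_0(k)$ and $h<1/\lambda$, the operator $A_k^h$ has a unique fixed point $u_k^h\in W_k$, and $$|u(x,a)-u_k^h(x,a)|\le M\Big(h+\frac{k}{\sqrt h}\Big)^{\gamma}\qquad\text{for all }x\in\Omega_k,\ a\in I_h .$$ -/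

import Mathlib

open MeasureTheory

namespace MonotoneControl

/-- The ambient state space `ℝ^ν` with its Euclidean norm. -/
abbrev Space (ν : ℕ) : Type := EuclideanSpace ℝ (Fin ν)

/-! ### The continuous control problem -/

/-- `α ∈ 𝒜(a)`: the control `α` is non-decreasing on `[0,∞)`, takes values in `[0,1]` there and
starts at a value at least `a`. Values at negative times are irrelevant. -/
def IsControl (a : ℝ) (α : ℝ → ℝ) : Prop :=
  MonotoneOn α (Set.Ici 0) ∧ (∀ s, 0 ≤ s → α s ∈ Set.Icc (0 : ℝ) 1) ∧ a ≤ α 0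

/-- `y` is a trajectory in `Ω`, on `[0,∞)`, of `y' = g(y, α)`, `y(0) = x`. As the control may jump,
the differential equation is meant in the usual integrated (Carathéodory) sense. -/
def IsTrajectory {ν : ℕ} (Ω : Set (Space ν)) (g : Space ν → ℝ → Space ν) (x : Space ν)
    (α : ℝ → ℝ) (y : ℝ → Space ν) : Prop :=
  ContinuousOn y (Set.Ici 0) ∧ (∀ s, 0 ≤ s → y s ∈ Ω) ∧
    ∀ t, 0 ≤ t → IntervalIntegrable (fun s => g (y s) (α s)) volume 0 t ∧
      y t = x + ∫ s in (0 : ℝ)..t, g (y s) (α s)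

/-- The discounted cost `∫₀^∞ f(y(s), α(s)) e^{-λ s} ds` of a trajectory with its control. -/
noncomputable def cost {ν : ℕ} (f : Space ν → ℝ → ℝ) (lam : ℝ) (α : ℝ → ℝ) (y : ℝ → Space ν) : ℝ :=
  ∫ s in Set.Ioi (0 : ℝ), f (y s) (α s) * Real.exp (-lam * s)

/-- The value function `u(x,a)`: the infimum of the costs of the controls in `𝒜(a)`. -/
noncomputable def valueFunction {ν : ℕ} (Ω : Set (Space ν)) (g : Space ν → ℝ → Space ν)
    (f : Space ν → ℝ → ℝ) (lam : ℝ) (x : Space ν) (a : ℝ) : ℝ :=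
  sInf {J : ℝ | ∃ α y, IsControl a α ∧ IsTrajectory Ω g x α y ∧ J = cost f lam α y}

/-- Boundedness by `C` and Lipschitz continuity with constant `L` on `Ω × [0,1]`. -/
def IsBoundedLipschitz {ν : ℕ} {F : Type*} [NormedAddCommGroup F] (Ω : Set (Space ν))
    (φ : Space ν → ℝ → F) (L C : ℝ) : Prop :=
  (∀ x ∈ Ω, ∀ x' ∈ Ω, ∀ a ∈ Set.Icc (0 : ℝ) 1, ∀ a' ∈ Set.Icc (0 : ℝ) 1,
      ‖φ x a - φ x' a'‖ ≤ L * (‖x - x'‖ + |a - a'|)) ∧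
    ∀ x ∈ Ω, ∀ a ∈ Set.Icc (0 : ℝ) 1, ‖φ x a‖ ≤ C

/-! ### Time and control discretization -/

/-- Admissible time steps: `h > 0` and `1/h` is an integer. -/
def IsStep (h : ℝ) : Prop := ∃ n : ℕ, 0 < n ∧ h = 1 / (n : ℝ)

/-- The grid `I_h = {i h | i = 0, …, 1/h}`. -/
def controlGrid (h : ℝ) : Set ℝ := {a | ∃ i : ℕ, (i : ℝ) ≤ 1 / h ∧ a = i * h}

/-- `I_h(a) = I_h ∩ [a,1]`. -/
def controlGridFrom (h a : ℝ) : Set ℝ := controlGrid h ∩ Set.Icc a 1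

/-- `(A^{h,b} w)(x,a) = (1 - λ h) w(x + h g(x,a), b) + h f(x,a)`. -/
def stepOp {ν : ℕ} (g : Space ν → ℝ → Space ν) (f : Space ν → ℝ → ℝ) (lam h b : ℝ)
    (w : Space ν → ℝ → ℝ) (x : Space ν) (a : ℝ) : ℝ :=
  (1 - lam * h) * w (x + h • g x a) b + h * f x a

/-! ### Triangulations and linear finite elements -/

/-- A finite (conforming) simplicial complex all of whose maximal simplices have full dimension
`ν`. Its space is the polyhedron `Ω_k`, its set of vertices is `V^k`. -/
def IsTriangulation {ν : ℕ} (T : Geometry.SimplicialComplex ℝ (Space ν)) : Prop :=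
  T.faces.Finite ∧ ∀ s ∈ T.faces, ∃ t ∈ T.faces, s ⊆ t ∧ t.card = ν + 1

/-- The `ν`-dimensional simplices `S_j^k` of a triangulation, given by their sets of vertices. -/
def cells {ν : ℕ} (T : Geometry.SimplicialComplex ℝ (Space ν)) : Set (Finset (Space ν)) :=
  {s | s ∈ T.faces ∧ s.card = ν + 1}

/-- The closed simplex with vertex set `s`. -/
def simplexOf {ν : ℕ} (s : Finset (Space ν)) : Set (Space ν) := convexHull ℝ (s : Set (Space ν))

/-- `w ∈ W_k`: for every `a ∈ I_h` the function `w(·,a)` is continuous on `Ω_k` and has a constant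
gradient in the interior of each simplex. Functions on `Ω_k × I_h` are represented by total
functions whose other values play no role. -/
def IsFiniteElement {ν : ℕ} (T : Geometry.SimplicialComplex ℝ (Space ν)) (h : ℝ)
    (w : Space ν → ℝ → ℝ) : Prop :=
  ∀ a ∈ controlGrid h, ContinuousOn (fun x => w x a) T.space ∧
    ∀ s ∈ cells T, ∃ p : Space ν →L[ℝ] ℝ, ∀ x ∈ interior (simplexOf s),
      HasFDerivAt (fun z => w z a) p x

/-- `v = A_k^h w`: `v` is the element of `W_k` whose value at every node `(x,a)`, with `x` a vertex
and `a ∈ I_h`, is the minimum of `(A^{h,b} w)(x,a)` over `b ∈ I_h(a)`. -/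
def IsDiscreteImage {ν : ℕ} (g : Space ν → ℝ → Space ν) (f : Space ν → ℝ → ℝ) (lam h : ℝ)
    (T : Geometry.SimplicialComplex ℝ (Space ν)) (w v : Space ν → ℝ → ℝ) : Prop :=
  IsFiniteElement T h v ∧ ∀ x ∈ T.vertices, ∀ a ∈ controlGrid h,
    IsLeast ((fun b => stepOp g f lam h b w x a) '' controlGridFrom h a) (v x a)

/-- `w ∈ W_k` is a fixed point of `A_k^h`, that is, a fully discrete solution `u_k^h`. -/
def IsDiscreteSolution {ν : ℕ} (g : Space ν → ℝ → Space ν) (f : Space ν → ℝ → ℝ) (lam h : ℝ)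
    (T : Geometry.SimplicialComplex ℝ (Space ν)) (w : Space ν → ℝ → ℝ) : Prop :=
  IsDiscreteImage g f lam h T w w

/-- The standing assumptions on a family `(T k)` of triangulations, with `k` ranging over the set
`Ks` of mesh parameters. The bound `h₀ k` is the largest time step for which the discrete dynamics
is required to leave `Ω_k` invariant; a bound independent of `k` is a special case. -/
structure IsTriangulationFamily {ν : ℕ} (Ω : Set (Space ν)) (g : Space ν → ℝ → Space ν)
    (χ₁ C₅ : ℝ) (Ks : Set ℝ) (T : ℝ → Geometry.SimplicialComplex ℝ (Space ν)) (h₀ : ℝ → ℝ) :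
    Prop where
  pos : ∀ k ∈ Ks, 0 < k
  triangulation : ∀ k ∈ Ks, IsTriangulation (T k)
  /-- the largest diameter of a simplex is `k` -/
  max_diam : ∀ k ∈ Ks, IsGreatest ((fun s => Metric.diam (simplexOf s)) '' cells (T k)) k
  h₀_pos : ∀ k ∈ Ks, 0 < h₀ k
  /-- the discrete dynamics stays in `Ω_k` -/
  invariant : ∀ k ∈ Ks, ∀ h, IsStep h → h < h₀ k → ∀ x ∈ (T k).space, ∀ a ∈ controlGrid h,
    x + h • g x a ∈ (T k).space
  subset : ∀ k ∈ Ks, (T k).space ⊆ Ω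
  /-- `Ω_k` exhausts `Ω` as `k → 0` -/
  exhausts : ∀ K : Set (Space ν), IsCompact K → K ⊆ Ω →
    ∃ kbar > 0, ∀ k ∈ Ks, k ≤ kbar → K ⊆ (T k).space
  /-- each simplex contains a ball in its interior. The comparison of its radius with the diameter
  is the weak one, `r ≤ χ₁ d`; it also holds when there is such a ball with `r ≥ χ₁ d`, since
  balls may be shrunk. -/
  inner_ball : ∀ k ∈ Ks, ∀ s ∈ cells (T k), ∃ c r, 0 < r ∧
    r ≤ χ₁ * Metric.diam (simplexOf s) ∧ Metric.closedBall c r ⊆ interior (simplexOf s)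
  quasi_uniform : ∀ k ∈ Ks, ∀ s ∈ cells (T k), k / Metric.diam (simplexOf s) ≤ C₅

end MonotoneControl

namespace MonotoneControl

variable {ν : ℕ} {Ω : Set (Space ν)} {g : Space ν → ℝ → Space ν} {f : Space ν → ℝ → ℝ}
  {lam Lg Mg Lf Mf h : ℝ} {α : ℝ → ℝ} {x y₀ : Space ν} {y : ℝ → Space ν}

/-! ### Running costs of trajectories -/

/-! Both functions are compared with the discounted cost of `n` explicit Euler steps, `eulerCost`,
and `n` is chosen at the end.

Trajectory against Euler (`abs_eulerCost_sub_cost_le`): a control is rounded to the grid, and on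
each time step the deviation is at most `h` plus an increment `Δ m`. Since controls are monotone
with values in `[0,1]`, the increments have a bounded sum (`IsControl.exists_isGridControl`), so
jumps contribute only `O(h)` in total.

Discrete solution against Euler (`le_eulerCost_add`, `le_add`): interpolation replaces a point by a
random vertex whose mean is that point and whose distance from it is at most `k`. Because the mean
is exact, each step adds `k²` to the mean square distance instead of `k` to the distance. The
potential `√(δ² + ‖x - y‖²)` with `k² = 2 Lg h δ²` absorbs this into the factor `1 + Lg h` already
caused by the dynamics. Hence `δ` is of order `k/√h`, which is better than the `k/h` given by adding
up distances.

In both comparisons errors accumulate through `growth`, and the neglected tail is a multiple of `(1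
- λh)^n`. For `L < λ` growth stays bounded and `n` may be as large as desired; for `L > λ` the two
terms are balanced, which produces the exponent `λ/L`; the critical case follows by enlarging `L`.
Existence and uniqueness come from contraction by `1 - λh` on nodal values. -/

lemma IsTrajectory.norm_sub_le (hg : IsBoundedLipschitz Ω g Lg Mg) (hα : IsControl 0 α)
    (hy : IsTrajectory Ω g y₀ α y) {t : ℝ} (ht : 0 ≤ t) : ‖y t - y₀‖ ≤ Mg * t := by
  rw [(hy.2.2 t ht).2, add_sub_cancel_left]
  have := intervalIntegral.norm_integral_le_of_norm_le_const (a := 0) (b := t)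
    (f := fun s => g (y s) (α s)) (C := Mg) fun s hs => by
      rw [Set.uIoc_of_le ht] at hs
      exact hg.2 _ (hy.2.1 s hs.1.le) _ (hα.2.1 s hs.1.le)
  simpa [abs_of_nonneg ht] using this

lemma IsControl.shift {a : ℝ} (hα : IsControl a α) (hh : 0 ≤ h) :
    IsControl a (fun s => α (s + h)) := by
  refine ⟨fun s hs t ht hst => hα.1 ?_ ?_ (by linarith), fun s hs => hα.2.1 _ (by linarith),
    hα.2.2.trans (hα.1 ?_ ?_ ?_)⟩ <;> simp only [Set.mem_Ici, zero_add, le_refl] at * <;> linarith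

lemma IsTrajectory.shift (hy : IsTrajectory Ω g y₀ α y) (hh : 0 ≤ h) :
    IsTrajectory Ω g (y h) (fun s => α (s + h)) (fun s => y (s + h)) := by
  refine ⟨hy.1.comp (by fun_prop) fun s hs => ?_, fun s hs => hy.2.1 _ (by linarith),
    fun t ht => ?_⟩
  · simp only [Set.mem_Ici] at *; linarith
  have hth : 0 ≤ t + h := by linarith
  have h1 := (hy.2.2 h hh).1
  have h2 := (hy.2.2 (t + h) hth).1
  have h3 : IntervalIntegrable (fun s => g (y s) (α s)) volume h (t + h) := h1.symm.trans h2
  constructor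
  · have := h3.comp_add_right h
    simpa using this
  · change y (t + h) = _
    rw [intervalIntegral.integral_comp_add_right (fun s => g (y s) (α s)), zero_add,
      (hy.2.2 (t + h) hth).2, (hy.2.2 h hh).2, add_assoc,
      intervalIntegral.integral_add_adjacent_intervals h1 h3]

/-- `f` is controlled only on `Ω × [0,1]`. It is Lipschitz there, so it has a continuous extension
to the whole space, which is composed with the continuous `y` and the monotone `α`. -/
lemma aestronglyMeasurable_comp_trajectory (hLf : 0 < Lf) (hf : IsBoundedLipschitz Ω f Lf Mf)
    (hα : IsControl 0 α) (hy : IsTrajectory Ω g y₀ α y) :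
    AEStronglyMeasurable (fun s => f (y s) (α s)) (volume.restrict (Set.Ioi 0)) := by
  have hlip : LipschitzOnWith (Real.toNNReal (2 * Lf)) (fun p : Space ν × ℝ => f p.1 p.2)
      (Ω ×ˢ Set.Icc 0 1) := by
    refine LipschitzOnWith.of_dist_le_mul fun p hp q hq => ?_
    rw [Real.coe_toNNReal _ (by positivity), Real.dist_eq]
    have h1 := hf.1 _ hp.1 _ hq.1 _ hp.2 _ hq.2
    have h2 : ‖p.1 - q.1‖ ≤ dist p q := by
      rw [← dist_eq_norm, Prod.dist_eq]; exact le_max_left _ _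
    have h3 : |p.2 - q.2| ≤ dist p q := by
      rw [← Real.dist_eq, Prod.dist_eq]; exact le_max_right _ _
    rw [Real.norm_eq_abs] at h1
    nlinarith
  obtain ⟨F, hF, hFf⟩ := hlip.extend_real
  have hym : AEMeasurable y (volume.restrict (Set.Ioi 0)) :=
    (hy.1.mono Set.Ioi_subset_Ici_self).aemeasurable measurableSet_Ioi
  have hαm : AEMeasurable α (volume.restrict (Set.Ioi 0)) :=
    aemeasurable_restrict_of_monotoneOn measurableSet_Ioi (hα.1.mono Set.Ioi_subset_Ici_self)
  refine AEStronglyMeasurable.congr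
    (hF.continuous.measurable.comp_aemeasurable (hym.prodMk hαm)).aestronglyMeasurable ?_
  filter_upwards [ae_restrict_mem measurableSet_Ioi] with s hs
  have hs' : 0 ≤ s := le_of_lt hs
  exact (hFf ⟨hy.2.1 s hs', hα.2.1 s hs'⟩).symm

lemma integrableOn_runningCost (hlam : 0 < lam) (hLf : 0 < Lf)
    (hf : IsBoundedLipschitz Ω f Lf Mf) (hα : IsControl 0 α) (hy : IsTrajectory Ω g y₀ α y) :
    IntegrableOn (fun s => f (y s) (α s) * Real.exp (-lam * s)) (Set.Ioi 0) := by
  refine Integrable.bdd_mul (c := Mf) (exp_neg_integrableOn_Ioi 0 hlam)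
    (aestronglyMeasurable_comp_trajectory hLf hf hα hy) ?_
  filter_upwards [ae_restrict_mem measurableSet_Ioi] with s hs
  have hs' : 0 ≤ s := le_of_lt hs
  exact hf.2 _ (hy.2.1 s hs') _ (hα.2.1 s hs')

lemma abs_cost_le (hlam : 0 < lam) (hf : IsBoundedLipschitz Ω f Lf Mf) (hα : IsControl 0 α)
    (hy : IsTrajectory Ω g y₀ α y) : |cost f lam α y| ≤ Mf / lam := by
  have h1 : ‖cost f lam α y‖ ≤ ∫ s in Set.Ioi (0 : ℝ), Mf * Real.exp (-lam * s) := by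
    refine norm_integral_le_of_norm_le ((exp_neg_integrableOn_Ioi 0 hlam).const_mul Mf) ?_
    filter_upwards [ae_restrict_mem measurableSet_Ioi] with s hs
    have hs' : 0 ≤ s := le_of_lt hs
    rw [norm_mul, Real.norm_of_nonneg (Real.exp_nonneg _)]
    exact mul_le_mul_of_nonneg_right (hf.2 _ (hy.2.1 s hs') _ (hα.2.1 s hs')) (Real.exp_nonneg _)
  rw [integral_const_mul, integral_exp_mul_Ioi (by linarith)] at h1
  simpa [div_eq_mul_inv] using h1

lemma cost_eq_add (hlam : 0 < lam) (hLf : 0 < Lf) (hf : IsBoundedLipschitz Ω f Lf Mf)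
    (hα : IsControl 0 α) (hy : IsTrajectory Ω g y₀ α y) (hh : 0 ≤ h) :
    cost f lam α y = (∫ s in (0 : ℝ)..h, f (y s) (α s) * Real.exp (-lam * s)) +
      Real.exp (-lam * h) * cost f lam (fun s => α (s + h)) (fun s => y (s + h)) := by
  have hint := integrableOn_runningCost hlam hLf hf hα hy
  have hshift := (measurePreserving_add_right volume h).setIntegral_preimage_emb
    (measurableEmbedding_addRight h) (fun s => f (y s) (α s) * Real.exp (-lam * s)) (Set.Ioi h)
  unfold cost
  rw [← Set.Ioc_union_Ioi_eq_Ioi hh, setIntegral_union (Set.Ioc_disjoint_Ioi le_rfl)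
    measurableSet_Ioi (hint.mono_set Set.Ioc_subset_Ioi_self)
    (hint.mono_set (Set.Ioi_subset_Ioi hh)), intervalIntegral.integral_of_le hh, ← hshift,
    ← integral_const_mul]
  congr 1
  have : (fun s => s + h) ⁻¹' Set.Ioi h = Set.Ioi 0 := by ext s; simp
  rw [Set.Ioc_union_Ioi_eq_Ioi hh, this]
  congr 1
  ext s
  rw [show -lam * (s + h) = -lam * h + -lam * s by ring, Real.exp_add]
  ring

/-! ### Comparison of a trajectory with the explicit Euler scheme -/

/-- The discounted cost of the first `n` steps of the explicit Euler scheme driven by `c`. -/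
noncomputable def eulerCost (g : Space ν → ℝ → Space ν) (f : Space ν → ℝ → ℝ) (lam h : ℝ) :
    ℕ → Space ν → (ℕ → ℝ) → ℝ
  | 0, _, _ => 0
  | n + 1, x, c => h * f x (c 0) +
      (1 - lam * h) * eulerCost g f lam h n (x + h • g x (c 0)) (fun m => c (m + 1))

/-- The solution of `A (n + 1) = (1 - λ h) (1 + L h) A n + b h`, `A 0 = 0`. -/
noncomputable def growth (lam L b h : ℝ) : ℕ → ℝ
  | 0 => 0
  | n + 1 => (1 - lam * h) * (1 + L * h) * growth lam L b h n + b * h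

lemma growth_nonneg {L b : ℝ} (hL : 0 ≤ L) (hb : 0 ≤ b) (hh : 0 ≤ h) (hlh : lam * h ≤ 1) (n : ℕ) :
    0 ≤ growth lam L b h n := by
  induction n with
  | zero => simp [growth]
  | succ n ih =>
    have : 0 ≤ 1 - lam * h := by linarith
    unfold growth; positivity

/-- The factor is at most `1 - (λ - L)h`, and the bound is the fixed point of the recursion with
that factor. -/
lemma growth_le_of_lt {L b : ℝ} (hL : 0 ≤ L) (hb : 0 ≤ b) (hh : 0 ≤ h) (hlam : 0 ≤ lam)
    (hlt : L < lam) (hlh : lam * h ≤ 1) (n : ℕ) : growth lam L b h n ≤ b / (lam - L) := by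
  have hpos : 0 < lam - L := by linarith
  induction n with
  | zero => simp only [growth]; positivity
  | succ n ih =>
    have h1 : (1 - lam * h) * (1 + L * h) ≤ 1 - (lam - L) * h := by
      have : 0 ≤ lam * L * h ^ 2 := by positivity
      nlinarith
    have h0 := growth_nonneg (lam := lam) hL hb hh hlh n
    have h2 : 0 ≤ 1 - (lam - L) * h := by nlinarith [mul_nonneg hL hh]
    unfold growth
    calc _ ≤ (1 - (lam - L) * h) * growth lam L b h n + b * h := by gcongr
      _ ≤ (1 - (lam - L) * h) * (b / (lam - L)) + b * h := by gcongr
      _ = b / (lam - L) := by field_simp; ring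

/-- The factor is at most `1 + (L - λ)h`; the recursion with that factor is a geometric sum, and `1
+ x ≤ exp x` finishes. -/
lemma growth_le_of_gt {L b : ℝ} (hL : 0 ≤ L) (hb : 0 ≤ b) (hh : 0 ≤ h) (hlam : 0 ≤ lam)
    (hlt : lam < L) (hlh : lam * h ≤ 1) (n : ℕ) :
    growth lam L b h n ≤ b / (L - lam) * Real.exp ((L - lam) * (n * h)) := by
  have hpos : 0 < L - lam := by linarith
  have key : growth lam L b h n ≤ b / (L - lam) * ((1 + (L - lam) * h) ^ n - 1) := by
    induction n with
    | zero => simp [growth]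
    | succ n ih =>
      have h1 : (1 - lam * h) * (1 + L * h) ≤ 1 + (L - lam) * h := by
        have : 0 ≤ lam * L * h ^ 2 := by positivity
        nlinarith
      have h0 := growth_nonneg (lam := lam) hL hb hh hlh n
      unfold growth
      calc _ ≤ (1 + (L - lam) * h) * growth lam L b h n + b * h := by gcongr
        _ ≤ (1 + (L - lam) * h) * (b / (L - lam) * ((1 + (L - lam) * h) ^ n - 1)) + b * h := by
            gcongr
        _ = _ := by field_simp; ring
  refine key.trans (mul_le_mul_of_nonneg_left ?_ (by positivity))
  have h2 : (1 + (L - lam) * h) ^ n ≤ Real.exp ((L - lam) * h) ^ n := by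
    gcongr
    linarith [Real.add_one_le_exp ((L - lam) * h)]
  rw [← Real.exp_nat_mul, show (n : ℝ) * ((L - lam) * h) = (L - lam) * (n * h) by ring] at h2
  linarith

lemma mem_Icc_of_mem_controlGrid (hh : 0 < h) {a : ℝ} (ha : a ∈ controlGrid h) :
    a ∈ Set.Icc (0 : ℝ) 1 := by
  obtain ⟨i, hi, rfl⟩ := ha
  exact ⟨by positivity, by rwa [le_div_iff₀ hh] at hi⟩

/-- From `exp t ≥ 1 + t` and `(1 + t)(1 - t + t²) = 1 + t³ ≥ 1`. -/
lemma exp_neg_le_one_sub_add_sq {t : ℝ} (ht : 0 ≤ t) : Real.exp (-t) ≤ 1 - t + t ^ 2 := by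
  have h1 := Real.add_one_le_exp t
  rw [Real.exp_neg]
  refine (inv_anti₀ (by positivity) h1).trans ?_
  rw [inv_le_iff_one_le_mul₀ (by positivity)]
  nlinarith [pow_nonneg ht 3]

lemma norm_euler_step_sub_le (hLg : 0 ≤ Lg) (hh : 0 ≤ h) (hg : IsBoundedLipschitz Ω g Lg Mg)
    (hα : IsControl 0 α) (hy : IsTrajectory Ω g y₀ α y) (hx : x ∈ Ω) {a D : ℝ}
    (ha : a ∈ Set.Icc (0 : ℝ) 1) (hMg : 0 ≤ Mg)
    (hD : ∀ s, 0 < s → s ≤ h → |α s - a| ≤ D) :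
    ‖x + h • g x a - y h‖ ≤ ‖x - y₀‖ + Lg * h * (‖x - y₀‖ + Mg * h + D) := by
  have hi := (hy.2.2 h hh).1
  have h1 : x + h • g x a - y h = (x - y₀) + ∫ s in (0 : ℝ)..h, (g x a - g (y s) (α s)) := by
    rw [intervalIntegral.integral_sub (by simp) hi, (hy.2.2 h hh).2]
    simp; abel
  have h2 : ‖∫ s in (0 : ℝ)..h, (g x a - g (y s) (α s))‖ ≤
      Lg * (‖x - y₀‖ + Mg * h + D) * |h - 0| := by
    refine intervalIntegral.norm_integral_le_of_norm_le_const fun s hs => ?_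
    rw [Set.uIoc_of_le hh] at hs
    refine (hg.1 _ hx _ (hy.2.1 s hs.1.le) _ ha _ (hα.2.1 s hs.1.le)).trans ?_
    have h3 := hy.norm_sub_le hg hα hs.1.le
    have h4 : ‖x - y s‖ ≤ ‖x - y₀‖ + ‖y s - y₀‖ := by
      rw [show x - y s = (x - y₀) - (y s - y₀) by abel]; exact norm_sub_le _ _
    have h5 := hD s hs.1 hs.2
    rw [abs_sub_comm] at h5
    have h6 : Mg * s ≤ Mg * h := mul_le_mul_of_nonneg_left hs.2 hMg
    gcongr
    linarith
  rw [h1]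
  refine (norm_add_le _ _).trans ?_
  rw [sub_zero, abs_of_nonneg hh] at h2
  linarith

lemma abs_step_cost_sub_le (hlam : 0 < lam) (hLf : 0 < Lf) (hh : 0 ≤ h)
    (hg : IsBoundedLipschitz Ω g Lg Mg) (hf : IsBoundedLipschitz Ω f Lf Mf)
    (hα : IsControl 0 α) (hy : IsTrajectory Ω g y₀ α y) (hx : x ∈ Ω) {a D : ℝ}
    (ha : a ∈ Set.Icc (0 : ℝ) 1) (hMg : 0 ≤ Mg)
    (hD : ∀ s, 0 < s → s ≤ h → |α s - a| ≤ D) :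
    |h * f x a - ∫ s in (0 : ℝ)..h, f (y s) (α s) * Real.exp (-lam * s)| ≤
      Lf * h * (‖x - y₀‖ + Mg * h + D) + lam * Mf * h ^ 2 := by
  have hi : IntervalIntegrable (fun s => f (y s) (α s) * Real.exp (-lam * s)) volume 0 h := by
    rw [intervalIntegrable_iff_integrableOn_Ioc_of_le hh]
    exact (integrableOn_runningCost hlam hLf hf hα hy).mono_set Set.Ioc_subset_Ioi_self
  have h1 : h * f x a - ∫ s in (0 : ℝ)..h, f (y s) (α s) * Real.exp (-lam * s) =
      ∫ s in (0 : ℝ)..h, (f x a - f (y s) (α s) * Real.exp (-lam * s)) := by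
    rw [intervalIntegral.integral_sub (by simp) hi]
    simp
  have h2 : ‖∫ s in (0 : ℝ)..h, (f x a - f (y s) (α s) * Real.exp (-lam * s))‖ ≤
      (Lf * (‖x - y₀‖ + Mg * h + D) + lam * Mf * h) * |h - 0| := by
    refine intervalIntegral.norm_integral_le_of_norm_le_const fun s hs => ?_
    rw [Set.uIoc_of_le hh] at hs
    have h3 := hy.norm_sub_le hg hα hs.1.le
    have h4 : ‖x - y s‖ ≤ ‖x - y₀‖ + ‖y s - y₀‖ := by
      rw [show x - y s = (x - y₀) - (y s - y₀) by abel]; exact norm_sub_le _ _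
    have h5 := hD s hs.1 hs.2
    rw [abs_sub_comm] at h5
    have h6 : Mg * s ≤ Mg * h := mul_le_mul_of_nonneg_left hs.2 hMg
    have h7 := hf.1 _ hx _ (hy.2.1 s hs.1.le) _ ha _ (hα.2.1 s hs.1.le)
    have h8 := hf.2 _ (hy.2.1 s hs.1.le) _ (hα.2.1 s hs.1.le)
    have h9 := Real.add_one_le_exp (-lam * s)
    have h10 : Real.exp (-lam * s) ≤ 1 := Real.exp_le_one_iff.2 (by nlinarith [hs.1])
    have h11 : lam * s ≤ lam * h := mul_le_mul_of_nonneg_left hs.2 hlam.le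
    have hM : 0 ≤ Mf := (norm_nonneg _).trans h8
    rw [show f x a - f (y s) (α s) * Real.exp (-lam * s) =
      (f x a - f (y s) (α s)) + f (y s) (α s) * (1 - Real.exp (-lam * s)) by ring]
    refine (norm_add_le _ _).trans (add_le_add (h7.trans ?_) ?_)
    · gcongr
      linarith
    · rw [norm_mul, Real.norm_of_nonneg (r := 1 - _) (by linarith), mul_comm lam, mul_assoc]
      gcongr
      linarith
  rw [h1, ← Real.norm_eq_abs]
  refine h2.trans (le_of_eq ?_)
  rw [sub_zero, abs_of_nonneg hh]
  ring

/-- The Euler scheme with a grid control `c` against a trajectory whose control differs from `c m`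
by at most `Δ m + h` on the `m`-th time interval. -/
theorem abs_eulerCost_sub_cost_le {S : Set (Space ν)} (hlam : 0 < lam) (hLg : 0 < Lg)
    (hMg : 0 < Mg) (hLf : 0 < Lf) (hMf : 0 < Mf)
    (hg : IsBoundedLipschitz Ω g Lg Mg) (hf : IsBoundedLipschitz Ω f Lf Mf)
    (hh : 0 < h) (hlh : lam * h ≤ 1) (hS : S ⊆ Ω)
    (hinv : ∀ x ∈ S, ∀ a ∈ controlGrid h, x + h • g x a ∈ S) (n : ℕ) :
    ∀ (x : Space ν) (c : ℕ → ℝ) (α : ℝ → ℝ) (y₀ : Space ν) (y : ℝ → Space ν) (Δ : ℕ → ℝ),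
      x ∈ S → (∀ m, c m ∈ controlGrid h) → IsControl 0 α → IsTrajectory Ω g y₀ α y →
      (∀ m, 0 ≤ Δ m) →
      (∀ (m : ℕ) (s : ℝ), m * h < s → s ≤ (m + 1) * h → |α s - c m| ≤ Δ m + h) →
      |eulerCost g f lam h n x c - cost f lam α y| ≤
        growth lam Lg Lf h n *
            (‖x - y₀‖ + (Mg + 1) * h + Lg * h * ∑ m ∈ Finset.range n, Δ m) +
          Lf * h * ∑ m ∈ Finset.range n, Δ m + 2 * Mf * h + (1 - lam * h) ^ n * (Mf / lam) := by
  induction n with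
  | zero =>
    intro x c α y₀ y Δ _ _ hα hy _ _
    have := abs_cost_le hlam hf hα hy
    simp only [eulerCost, growth, Finset.range_zero, Finset.sum_empty, zero_sub, abs_neg]
    have : 0 ≤ Mf * h := by positivity
    simp; linarith
  | succ n ih =>
    intro x c α y₀ y Δ hx hc hα hy hΔ hαc
    have hD : ∀ s, 0 < s → s ≤ h → |α s - c 0| ≤ Δ 0 + h := fun s h1 h2 =>
      hαc 0 s (by simpa using h1) (by simpa using h2)
    have ha := mem_Icc_of_mem_controlGrid hh (hc 0)
    have hα' := hα.shift hh.le
    have hy' := hy.shift hh.le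
    have hstep := norm_euler_step_sub_le hLg.le hh.le hg hα hy (hS hx) ha hMg.le hD
    have hcost := abs_step_cost_sub_le hlam hLf hh.le hg hf hα hy (hS hx) ha hMg.le hD
    have hrec := ih _ (fun m => c (m + 1)) _ _ _ (fun m => Δ (m + 1)) (hinv x hx _ (hc 0))
      (fun m => hc _) hα' hy' (fun m => hΔ _) (fun m s h1 h2 => hαc (m + 1) (s + h)
        (by push_cast; linarith) (by push_cast; linarith))
    have hJ := abs_cost_le hlam hf hα' hy'
    rw [cost_eq_add hlam hLf hf hα hy hh.le, eulerCost, Finset.sum_range_succ']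
    have hA := growth_nonneg (lam := lam) hLg.le hLf.le hh.le hlh n
    rw [growth]
    set A := growth lam Lg Lf h n
    set J := cost f lam (fun s => α (s + h)) (fun s => y (s + h))
    set E := eulerCost g f lam h n (x + h • g x (c 0)) (fun m => c (m + 1))
    set I := ∫ s in (0 : ℝ)..h, f (y s) (α s) * Real.exp (-lam * s)
    set σ := ∑ m ∈ Finset.range n, Δ (m + 1)
    set r := ‖x - y₀‖
    have hr : 0 ≤ r := norm_nonneg _
    have hσ0 : 0 ≤ σ := Finset.sum_nonneg fun m _ => hΔ _
    have hd0 := hΔ 0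
    have hq : 0 ≤ 1 - lam * h := by linarith
    have hexp1 : Real.exp (-lam * h) ≤ 1 - lam * h + (lam * h) ^ 2 := by
      have := exp_neg_le_one_sub_add_sq (t := lam * h) (by positivity)
      rwa [← neg_mul] at this
    have hexp2 : 1 - lam * h ≤ Real.exp (-lam * h) := by
      linarith [Real.add_one_le_exp (-lam * h)]
    -- This and the discounting error in `hcost` add up to `2 λ Mf h²` per step, exactly what turns
    -- `(1 - λh) · 2 Mf h` back into `2 Mf h`.
    have hlast : |(Real.exp (-lam * h) - (1 - lam * h)) * J| ≤ lam * Mf * h ^ 2 := by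
      rw [abs_mul, abs_of_nonneg (by linarith)]
      calc _ ≤ (lam * h) ^ 2 * (Mf / lam) := by gcongr; linarith
        _ = _ := by field_simp
    have hsplit : |h * f x (c 0) + (1 - lam * h) * E - (I + Real.exp (-lam * h) * J)| ≤
        |h * f x (c 0) - I| + (1 - lam * h) * |E - J| +
          |(Real.exp (-lam * h) - (1 - lam * h)) * J| := by
      rw [show h * f x (c 0) + (1 - lam * h) * E - (I + Real.exp (-lam * h) * J) =
        (h * f x (c 0) - I) + (1 - lam * h) * (E - J) -
          (Real.exp (-lam * h) - (1 - lam * h)) * J by ring]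
      refine (abs_sub _ _).trans (add_le_add_left ((abs_add_le _ _).trans ?_) _)
      rw [abs_mul, abs_of_nonneg hq]
    -- The quantity multiplied by `growth` is a potential: it contains the future increments in
    -- advance, so one step enlarges it by no more than the factor `1 + Lg h`.
    have hpot : ‖x + h • g x (c 0) - y h‖ + (Mg + 1) * h + Lg * h * σ ≤
        (1 + Lg * h) * (r + (Mg + 1) * h + Lg * h * (σ + Δ 0)) := by
      have : 0 ≤ Lg * h * (Lg * h * (σ + Δ 0)) := by positivity
      nlinarith
    have hrec' : (1 - lam * h) * |E - J| ≤ (1 - lam * h) * (A * ((1 + Lg * h) *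
        (r + (Mg + 1) * h + Lg * h * (σ + Δ 0))) + Lf * h * σ + 2 * Mf * h +
          (1 - lam * h) ^ n * (Mf / lam)) := by
      refine mul_le_mul_of_nonneg_left (hrec.trans ?_) hq
      gcongr
    have e1 : (1 - lam * h) * (Lf * h * σ) ≤ Lf * h * σ :=
      mul_le_of_le_one_left (by positivity) (by nlinarith)
    have e2 : 0 ≤ Lf * h * (Lg * h * (σ + Δ 0)) := by positivity
    rw [pow_succ]
    nlinarith [hsplit, hcost, hrec', hlast]

end MonotoneControl

namespace MonotoneControl

/-! ### Comparison of the fully discrete solution with the Euler scheme -/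

/-- `μ` expresses `z` as a convex combination of the vertices in `s`, each within `k` of `z`,
and `w` is affine along this combination for all grid values. -/
structure IsInterpolated {ν : ℕ} (V : Set (Space ν)) (G : Set ℝ) (k : ℝ) (w : Space ν → ℝ → ℝ)
    (z : Space ν) (s : Finset (Space ν)) (μ : Space ν → ℝ) : Prop where
  subset : (s : Set (Space ν)) ⊆ V
  nonneg : ∀ x ∈ s, 0 ≤ μ x
  sum_eq_one : ∑ x ∈ s, μ x = 1
  sum_smul : ∑ x ∈ s, μ x • x = z
  norm_sub_le : ∀ x ∈ s, ‖x - z‖ ≤ k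
  apply_eq : ∀ a ∈ G, w z a = ∑ x ∈ s, μ x * w x a

variable {ν : ℕ} {Ω S V : Set (Space ν)} {G : Set ℝ} {g : Space ν → ℝ → Space ν}
  {f : Space ν → ℝ → ℝ} {w : Space ν → ℝ → ℝ} {lam Lg Mg Lf Mf h k δ : ℝ}

/-- Jensen for the square, then the bias–variance identity: the cross term vanishes because `μ` has
mean `z`, so the spread enters as `k²`. -/
lemma IsInterpolated.sum_sqrt_le {z : Space ν} {s : Finset (Space ν)} {μ : Space ν → ℝ}
    (hz : IsInterpolated V G k w z s μ) (y : Space ν) :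
    ∑ x ∈ s, μ x * √(δ ^ 2 + ‖x - y‖ ^ 2) ≤ √(δ ^ 2 + k ^ 2 + ‖z - y‖ ^ 2) := by
  have hcs : (∑ x ∈ s, μ x * √(δ ^ 2 + ‖x - y‖ ^ 2)) ^ 2 ≤
      ∑ x ∈ s, μ x * (√(δ ^ 2 + ‖x - y‖ ^ 2)) ^ 2 := by
    simpa using (convexOn_pow 2).map_sum_le (t := s) (w := μ)
      (p := fun x => √(δ ^ 2 + ‖x - y‖ ^ 2)) hz.nonneg hz.sum_eq_one
      fun x _ => Real.sqrt_nonneg _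
  have hvar : ∑ x ∈ s, μ x * ‖x - y‖ ^ 2 =
      ∑ x ∈ s, μ x * ‖x - z‖ ^ 2 + ‖z - y‖ ^ 2 := by
    have h1 : ∀ x : Space ν, μ x * ‖x - y‖ ^ 2 = μ x * ‖x - z‖ ^ 2 +
        2 * inner ℝ (μ x • x - μ x • z) (z - y) + μ x * ‖z - y‖ ^ 2 := fun x => by
      rw [show x - y = (x - z) + (z - y) by abel, norm_add_sq_real, ← smul_sub,
        real_inner_smul_left]
      ring
    simp_rw [h1, Finset.sum_add_distrib, ← Finset.mul_sum, ← sum_inner, Finset.sum_sub_distrib,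
      ← Finset.sum_smul, ← Finset.sum_mul, hz.sum_smul, hz.sum_eq_one]
    simp
  have hk : ∑ x ∈ s, μ x * ‖x - z‖ ^ 2 ≤ k ^ 2 := by
    calc _ ≤ ∑ x ∈ s, μ x * k ^ 2 := Finset.sum_le_sum fun x hx =>
          mul_le_mul_of_nonneg_left (pow_le_pow_left₀ (norm_nonneg _) (hz.norm_sub_le x hx) 2)
            (hz.nonneg x hx)
      _ = _ := by rw [← Finset.sum_mul, hz.sum_eq_one, one_mul]
  refine Real.le_sqrt_of_sq_le (hcs.trans ?_)
  have : ∀ x, (√(δ ^ 2 + ‖x - y‖ ^ 2)) ^ 2 = δ ^ 2 + ‖x - y‖ ^ 2 := fun x =>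
    Real.sq_sqrt (by positivity)
  simp_rw [this, mul_add, Finset.sum_add_distrib, ← Finset.sum_mul, hz.sum_eq_one, hvar]
  linarith

lemma IsInterpolated.apply_le {z : Space ν} {s : Finset (Space ν)} {μ : Space ν → ℝ}
    (hz : IsInterpolated V G k w z s μ) {a : ℝ} (ha : a ∈ G) {y : Space ν} {v A B : ℝ}
    (hA : 0 ≤ A)
    (hw : ∀ x ∈ V, w x a ≤ v + A * √(δ ^ 2 + ‖x - y‖ ^ 2) + B) :
    w z a ≤ v + A * √(δ ^ 2 + k ^ 2 + ‖z - y‖ ^ 2) + B := by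
  have h1 : w z a ≤ ∑ x ∈ s, μ x * (v + A * √(δ ^ 2 + ‖x - y‖ ^ 2) + B) := by
    rw [hz.apply_eq a ha]
    exact Finset.sum_le_sum fun x hx =>
      mul_le_mul_of_nonneg_left (hw x (hz.subset hx)) (hz.nonneg x hx)
  have h2 : ∑ x ∈ s, μ x * (v + A * √(δ ^ 2 + ‖x - y‖ ^ 2) + B) =
      v + A * (∑ x ∈ s, μ x * √(δ ^ 2 + ‖x - y‖ ^ 2)) + B := by
    have : ∀ x, μ x * (v + A * √(δ ^ 2 + ‖x - y‖ ^ 2) + B) =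
        μ x * v + A * (μ x * √(δ ^ 2 + ‖x - y‖ ^ 2)) + μ x * B := fun x => by ring
    simp_rw [this, Finset.sum_add_distrib, ← Finset.mul_sum, ← Finset.sum_mul, hz.sum_eq_one]
    ring
  have h3 := mul_le_mul_of_nonneg_left (hz.sum_sqrt_le (δ := δ) y) hA
  linarith

lemma IsInterpolated.neg {z : Space ν} {s : Finset (Space ν)} {μ : Space ν → ℝ}
    (hz : IsInterpolated V G k w z s μ) :
    IsInterpolated V G k (fun x a => -w x a) z s μ :=
  ⟨hz.subset, hz.nonneg, hz.sum_eq_one, hz.sum_smul, hz.norm_sub_le, fun a ha => by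
    simp [hz.apply_eq a ha]⟩

lemma IsInterpolated.le_apply {z : Space ν} {s : Finset (Space ν)} {μ : Space ν → ℝ}
    (hz : IsInterpolated V G k w z s μ) {a : ℝ} (ha : a ∈ G) {y : Space ν} {v A B : ℝ}
    (hA : 0 ≤ A)
    (hw : ∀ x ∈ V, v ≤ w x a + A * √(δ ^ 2 + ‖x - y‖ ^ 2) + B) :
    v ≤ w z a + A * √(δ ^ 2 + k ^ 2 + ‖z - y‖ ^ 2) + B := by
  have := hz.neg.apply_le (δ := δ) ha (y := y) (v := -v) (B := B) hA fun x hx => by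
    linarith [hw x hx]
  linarith

/-- The nodal equations of the fully discrete scheme together with the interpolation property,
on an invariant set `S` with node set `V`. -/
structure IsNodalSolution (Ω : Set (Space ν)) (g : Space ν → ℝ → Space ν) (f : Space ν → ℝ → ℝ)
    (lam h k B : ℝ) (S V : Set (Space ν)) (w : Space ν → ℝ → ℝ) : Prop where
  subset : S ⊆ Ω
  nodes : V ⊆ S
  invariant : ∀ x ∈ S, ∀ a ∈ controlGrid h, x + h • g x a ∈ S
  interp : ∀ z ∈ S, ∃ s μ, IsInterpolated V (controlGrid h) k w z s μ
  least : ∀ x ∈ V, ∀ a ∈ controlGrid h,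
    IsLeast ((fun b => stepOp g f lam h b w x a) '' controlGridFrom h a) (w x a)
  bound : ∀ x ∈ V, ∀ a ∈ controlGrid h, |w x a| ≤ B

/-- The relation between `k` and `δ` is chosen so that `δ² + k² ≤ (1 + Lg h)² δ²`: interpolation
then costs no more than the factor of the dynamics. -/
lemma sqrt_step_le (hLg : 0 < Lg) (hh : 0 < h) (hδ : k ^ 2 = 2 * Lg * h * δ ^ 2) {r r' : ℝ}
    (hr' : 0 ≤ r') (hrr : r' ≤ (1 + Lg * h) * r) :
    √(δ ^ 2 + k ^ 2 + r' ^ 2) ≤ (1 + Lg * h) * √(δ ^ 2 + r ^ 2) := by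
  have hp : 0 ≤ 1 + Lg * h := by positivity
  rw [Real.sqrt_le_left (by positivity), mul_pow, Real.sq_sqrt (by positivity)]
  have := pow_le_pow_left₀ hr' hrr 2
  have h2 : 0 ≤ (Lg * h) ^ 2 * δ ^ 2 := by positivity
  nlinarith

lemma norm_step_sub_le (hh : 0 < h) (hg : IsBoundedLipschitz Ω g Lg Mg)
    {x y : Space ν} (hx : x ∈ Ω) (hy : y ∈ Ω) {a : ℝ} (ha : a ∈ Set.Icc (0 : ℝ) 1) :
    ‖x + h • g x a - (y + h • g y a)‖ ≤ (1 + Lg * h) * ‖x - y‖ := by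
  have h1 := hg.1 x hx y hy a ha a ha
  rw [sub_self, abs_zero, add_zero] at h1
  rw [show x + h • g x a - (y + h • g y a) = (x - y) + h • (g x a - g y a) by
    rw [smul_sub]; abel]
  refine (norm_add_le _ _).trans ?_
  rw [norm_smul, Real.norm_of_nonneg hh.le]
  nlinarith [mul_le_mul_of_nonneg_left h1 hh.le]

/-- Grid controls starting at `a`. -/
def IsGridControl (h a : ℝ) (c : ℕ → ℝ) : Prop :=
  c 0 = a ∧ Monotone c ∧ ∀ m, c m ∈ controlGrid h

/-! ### Bellman recursion against Euler costs -/

namespace IsNodalSolution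

variable {B : ℝ}

/-- The next value `c 1` of the given control competes in the minimum at `x`. The Euler point `y` is
never interpolated, so it ranges over all of `S`, while `x` returns to the nodes after each step. -/
lemma le_eulerCost_add_of_mem_nodes (hw : IsNodalSolution Ω g f lam h k B S V w)
    (hLg : 0 < Lg) (hLf : 0 < Lf) (hg : IsBoundedLipschitz Ω g Lg Mg)
    (hf : IsBoundedLipschitz Ω f Lf Mf) (hh : 0 < h) (hlh : lam * h ≤ 1)
    (hδ : k ^ 2 = 2 * Lg * h * δ ^ 2) (n : ℕ) :
    ∀ (c : ℕ → ℝ), Monotone c → (∀ m, c m ∈ controlGrid h) → ∀ y ∈ S, ∀ x ∈ V,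
      w x (c 0) ≤ eulerCost g f lam h n y c +
        growth lam Lg Lf h n * √(δ ^ 2 + ‖x - y‖ ^ 2) + (1 - lam * h) ^ n * B := by
  induction n with
  | zero =>
    intro c _ hc y _ x hx
    simpa [eulerCost, growth] using (abs_le.1 (hw.bound x hx _ (hc 0))).2
  | succ n ih =>
    intro c hmono hc y hy x hx
    have ha := mem_Icc_of_mem_controlGrid hh (hc 0)
    have hb : c 1 ∈ controlGridFrom h (c 0) :=
      ⟨hc 1, hmono zero_le_one, (mem_Icc_of_mem_controlGrid hh (hc 1)).2⟩
    have hle : w x (c 0) ≤ stepOp g f lam h (c 1) w x (c 0) :=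
      (hw.least x hx _ (hc 0)).2 ⟨_, hb, rfl⟩
    have hxΩ := hw.subset (hw.nodes hx)
    have hyΩ := hw.subset hy
    obtain ⟨s, μ, hsμ⟩ := hw.interp _ (hw.invariant x (hw.nodes hx) _ (hc 0))
    have hA := growth_nonneg (lam := lam) hLg.le hLf.le hh.le hlh n
    have hq : 0 ≤ 1 - lam * h := by linarith
    have h1 := hsμ.apply_le (hc 1) hA (ih (fun m => c (m + 1))
      (fun i j hij => hmono (by omega)) (fun m => hc _) _ (hw.invariant y hy _ (hc 0)))
    have h2 := mul_le_mul_of_nonneg_left (sqrt_step_le hLg hh hδ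
      (norm_nonneg _) (norm_step_sub_le hh hg hxΩ hyΩ ha)) hA
    have h3 := hf.1 x hxΩ y hyΩ _ ha _ ha
    rw [sub_self, abs_zero, add_zero, Real.norm_eq_abs] at h3
    have h4 : ‖x - y‖ ≤ √(δ ^ 2 + ‖x - y‖ ^ 2) :=
      Real.le_sqrt_of_sq_le (by linarith [sq_nonneg δ])
    have h5 : h * f x (c 0) ≤ h * f y (c 0) + Lf * h * √(δ ^ 2 + ‖x - y‖ ^ 2) := by
      have := mul_le_mul_of_nonneg_left ((le_abs_self _).trans h3) hh.le
      have := mul_le_mul_of_nonneg_left h4 (mul_pos hLf hh).le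
      nlinarith
    have h6 := mul_le_mul_of_nonneg_left (h1.trans (add_le_add_left (add_le_add_right h2 _) _)) hq
    simp only [stepOp] at hle
    rw [eulerCost, growth, pow_succ]
    refine hle.trans ((add_le_add h6 h5).trans (le_of_eq ?_))
    ring_nf

/-- Quantifying over lower bounds `v` of all Euler costs avoids building an optimal sequence, which
would depend on the random vertices reached by interpolation. -/
lemma le_add_of_mem_nodes (hw : IsNodalSolution Ω g f lam h k B S V w)
    (hLg : 0 < Lg) (hLf : 0 < Lf) (hg : IsBoundedLipschitz Ω g Lg Mg)
    (hf : IsBoundedLipschitz Ω f Lf Mf) (hh : 0 < h) (hlh : lam * h < 1)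
    (hδ : k ^ 2 = 2 * Lg * h * δ ^ 2) (n : ℕ) :
    ∀ a ∈ controlGrid h, ∀ y ∈ S, ∀ v : ℝ,
      (∀ c, IsGridControl h a c → v ≤ eulerCost g f lam h n y c) → ∀ x ∈ V,
      v ≤ w x a + growth lam Lg Lf h n * √(δ ^ 2 + ‖x - y‖ ^ 2) + (1 - lam * h) ^ n * B := by
  induction n with
  | zero =>
    intro a ha y _ v hv x hx
    have h1 := hv (fun _ => a) ⟨rfl, monotone_const, fun _ => ha⟩
    have h2 := (abs_le.1 (hw.bound x hx _ ha)).1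
    simp only [eulerCost] at h1
    simp only [growth]
    linarith
  | succ n ih =>
    intro a ha y hy v hv x hx
    have haI := mem_Icc_of_mem_controlGrid hh ha
    obtain ⟨b, hb, hwb⟩ := (hw.least x hx a ha).1
    have hxΩ := hw.subset (hw.nodes hx)
    have hyΩ := hw.subset hy
    obtain ⟨s, μ, hsμ⟩ := hw.interp _ (hw.invariant x (hw.nodes hx) _ ha)
    have hA := growth_nonneg (lam := lam) hLg.le hLf.le hh.le hlh.le n
    have hq : 0 < 1 - lam * h := by linarith
    -- With `b` the minimizer at `x`, putting `a` in front of a control starting at `b` is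
    -- admissible since `a ≤ b`. So a lower bound at `y` yields one at the next Euler point; the
    -- division needs `λh < 1`.
    have hv' : ∀ c, IsGridControl h b c →
        (v - h * f y a) / (1 - lam * h) ≤ eulerCost g f lam h n (y + h • g y a) c := by
      intro c hc
      rw [div_le_iff₀ hq]
      have := hv (fun m => Nat.casesOn m a c) ⟨rfl, monotone_nat_of_le_succ fun m => ?_,
        fun m => ?_⟩
      · change v ≤ h * f y a + (1 - lam * h) * eulerCost g f lam h n (y + h • g y a) c at this
        linarith
      · cases m with
        | zero => simpa [hc.1] using hb.2.1
        | succ m => exact hc.2.1 (Nat.le_succ m)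
      · cases m with
        | zero => exact ha
        | succ m => exact hc.2.2 m
    have h1 := hsμ.le_apply hb.1 hA (ih b hb.1 _ (hw.invariant y hy _ ha) _ hv')
    have h2 := mul_le_mul_of_nonneg_left (sqrt_step_le hLg hh hδ
      (norm_nonneg _) (norm_step_sub_le hh hg hxΩ hyΩ haI)) hA
    have h3 := hf.1 x hxΩ y hyΩ _ haI _ haI
    rw [sub_self, abs_zero, add_zero, Real.norm_eq_abs, abs_sub_comm] at h3
    have h4 : ‖x - y‖ ≤ √(δ ^ 2 + ‖x - y‖ ^ 2) :=
      Real.le_sqrt_of_sq_le (by linarith [sq_nonneg δ])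
    have h5 : h * f y a ≤ h * f x a + Lf * h * √(δ ^ 2 + ‖x - y‖ ^ 2) := by
      have := mul_le_mul_of_nonneg_left ((le_abs_self _).trans h3) hh.le
      have := mul_le_mul_of_nonneg_left h4 (mul_pos hLf hh).le
      nlinarith
    have h6 := mul_le_mul_of_nonneg_left (h1.trans (add_le_add_left (add_le_add_right h2 _) _))
      hq.le
    rw [mul_div_cancel₀ _ hq.ne'] at h6
    simp only [stepOp] at hwb
    rw [growth, pow_succ, ← hwb]
    refine (sub_le_iff_le_add.1 h6).trans ((add_le_add_right h5 _).trans (le_of_eq ?_))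
    ring_nf

/-- One more interpolation passes from nodes to arbitrary points; with `y = x` the distance vanishes
and `√(δ² + k²)` remains. -/
theorem le_eulerCost_add (hw : IsNodalSolution Ω g f lam h k B S V w)
    (hLg : 0 < Lg) (hLf : 0 < Lf) (hg : IsBoundedLipschitz Ω g Lg Mg)
    (hf : IsBoundedLipschitz Ω f Lf Mf) (hh : 0 < h) (hlh : lam * h ≤ 1)
    (hδ : k ^ 2 = 2 * Lg * h * δ ^ 2) (n : ℕ) {a : ℝ} {c : ℕ → ℝ} (hc : IsGridControl h a c)
    {x : Space ν} (hx : x ∈ S) :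
    w x a ≤ eulerCost g f lam h n x c + growth lam Lg Lf h n * √(δ ^ 2 + k ^ 2) +
      (1 - lam * h) ^ n * B := by
  obtain ⟨s, μ, hsμ⟩ := hw.interp x hx
  have := hsμ.apply_le (hc.2.2 0) (growth_nonneg (lam := lam) hLg.le hLf.le hh.le hlh n)
    (hw.le_eulerCost_add_of_mem_nodes hLg hLf hg hf hh hlh hδ n c hc.2.1 hc.2.2 x hx)
  simpa [hc.1] using this

theorem le_add (hw : IsNodalSolution Ω g f lam h k B S V w)
    (hLg : 0 < Lg) (hLf : 0 < Lf) (hg : IsBoundedLipschitz Ω g Lg Mg)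
    (hf : IsBoundedLipschitz Ω f Lf Mf) (hh : 0 < h) (hlh : lam * h < 1)
    (hδ : k ^ 2 = 2 * Lg * h * δ ^ 2) (n : ℕ) {a v : ℝ} (ha : a ∈ controlGrid h)
    {x : Space ν} (hx : x ∈ S)
    (hv : ∀ c, IsGridControl h a c → v ≤ eulerCost g f lam h n x c) :
    v ≤ w x a + growth lam Lg Lf h n * √(δ ^ 2 + k ^ 2) + (1 - lam * h) ^ n * B := by
  obtain ⟨s, μ, hsμ⟩ := hw.interp x hx
  have := hsμ.le_apply ha (growth_nonneg (lam := lam) hLg.le hLf.le hh.le hlh.le n)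
    (hw.le_add_of_mem_nodes hLg hLf hg hf hh hlh hδ n a ha x hx v hv)
  simpa using this

end IsNodalSolution

end MonotoneControl

namespace MonotoneControl

/-! ### Linear finite elements on a triangulation -/

variable {ν : ℕ} {T : Geometry.SimplicialComplex ℝ (Space ν)} {h k : ℝ}

lemma _root_.AffineMap.map_sum_smul {E : Type*} [AddCommGroup E] [Module ℝ E] (φ : E →ᵃ[ℝ] ℝ)
    {s : Finset E} {μ : E → ℝ} (hμ : ∑ x ∈ s, μ x = 1) :
    φ (∑ x ∈ s, μ x • x) = ∑ x ∈ s, μ x * φ x := by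
  have h1 := s.map_affineCombination (id : E → E) μ hμ φ
  rw [s.affineCombination_eq_linear_combination _ _ hμ,
    s.affineCombination_eq_linear_combination _ _ hμ] at h1
  simpa using h1

/-- The `ν + 1` affinely independent vertices form an affine basis; the map is the combination of
its barycentric coordinates. -/
lemma exists_affineMap_eq {s : Finset (Space ν)} (hs : s ∈ cells T) (u : Space ν → ℝ) :
    ∃ φ : Space ν →ᵃ[ℝ] ℝ, ∀ x ∈ s, φ x = u x := by
  have hind := T.indep hs.1
  have htop := hind.affineSpan_eq_top_iff_card_eq_finrank_add_one.2 (by simp [hs.2])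
  let b : AffineBasis s ℝ (Space ν) := ⟨_, hind, htop⟩
  refine ⟨∑ i : s, u i • b.coord i, fun x hx => ?_⟩
  have h1 : ∀ i : s, b.coord i x = if i = ⟨x, hx⟩ then 1 else 0 := fun i => by
    have := b.coord_apply i ⟨x, hx⟩
    exact this
  have h2 : ∀ (t : Finset s) (F : s → (Space ν →ᵃ[ℝ] ℝ)), (∑ i ∈ t, F i) x = ∑ i ∈ t, F i x := by
    intro t F
    induction t using Finset.cons_induction with
    | empty => simp
    | cons i t hi ih =>
      rw [Finset.sum_cons, Finset.sum_cons, ← ih]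
      rfl
  rw [h2]
  simp [h1]

lemma isCompact_simplexOf (s : Finset (Space ν)) : IsCompact (simplexOf s) :=
  s.finite_toSet.isCompact_convexHull ℝ

lemma IsTriangulation.exists_diam_le (hT : IsTriangulation T) :
    ∃ k, ∀ s ∈ cells T, Metric.diam (simplexOf s) ≤ k := by
  obtain ⟨k, hk⟩ := ((hT.1.subset fun s (hs : s ∈ cells T) => hs.1).image
    fun s => Metric.diam (simplexOf s)).bddAbove
  exact ⟨k, fun s hs => hk ⟨s, hs, rfl⟩⟩

lemma IsTriangulation.exists_cell (hT : IsTriangulation T) {x : Space ν} (hx : x ∈ T.space) :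
    ∃ s ∈ cells T, x ∈ simplexOf s := by
  obtain ⟨s, hs, hxs⟩ := Geometry.SimplicialComplex.mem_space_iff.1 hx
  obtain ⟨t, ht, hst, hcard⟩ := hT.2 s hs
  exact ⟨t, ⟨ht, hcard⟩, convexHull_mono (by exact_mod_cast hst) hxs⟩

lemma IsTriangulation.space_eq (hT : IsTriangulation T) :
    T.space = ⋃ s : cells T, simplexOf (s : Finset (Space ν)) := by
  ext x
  rw [Set.mem_iUnion]
  refine ⟨fun hx => ?_, fun ⟨s, hx⟩ => T.convexHull_subset_space s.2.1 hx⟩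
  obtain ⟨s, hs, hxs⟩ := hT.exists_cell hx
  exact ⟨⟨s, hs⟩, hxs⟩

lemma IsTriangulation.finite_vertices (hT : IsTriangulation T) : T.vertices.Finite := by
  rw [Geometry.SimplicialComplex.vertices_eq]
  exact hT.1.biUnion fun s _ => s.finite_toSet

lemma subset_vertices {s : Finset (Space ν)} (hs : s ∈ cells T) :
    (s : Set (Space ν)) ⊆ T.vertices := by
  rw [Geometry.SimplicialComplex.vertices_eq]
  exact Set.subset_biUnion_of_mem (u := fun s : Finset (Space ν) => (s : Set (Space ν))) hs.1

/-- The continuous piecewise affine interpolant of nodal values `u`. -/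
lemma IsTriangulation.exists_interpolant (hT : IsTriangulation T) (u : Space ν → ℝ) :
    ∃ w : Space ν → ℝ, (∀ x ∈ T.vertices, w x = u x) ∧
      ∀ s ∈ cells T, ∃ φ : Space ν →ᵃ[ℝ] ℝ, Set.EqOn w φ (simplexOf s) := by
  classical
  choose! φ hφ using fun s (hs : s ∈ cells T) => exists_affineMap_eq hs u
  choose! σ hσ using fun x (hx : x ∈ T.space) => hT.exists_cell hx
  -- Independence of the chosen cell is where conformity enters: a point of two cells lies in the
  -- hull of their common vertices, where both affine maps take the values `u`.
  have key : ∀ s ∈ cells T, ∀ x ∈ simplexOf s, φ (σ x) x = φ s x := by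
    intro s hs x hx
    have hσx := hσ x (T.convexHull_subset_space hs.1 hx)
    have h1 : x ∈ convexHull ℝ (((σ x ∩ s : Finset (Space ν))) : Set (Space ν)) := by
      rw [Finset.coe_inter, ← T.convexHull_inter_convexHull hσx.1.1 hs.1]
      exact ⟨hσx.2, hx⟩
    obtain ⟨μ, -, hμ1, hμx⟩ := Finset.mem_convexHull'.1 h1
    have h2 : ∀ ψ : Space ν →ᵃ[ℝ] ℝ, ψ x = ∑ v ∈ σ x ∩ s, μ v * ψ v := fun ψ => by
      rw [← AffineMap.map_sum_smul _ hμ1, hμx]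
    rw [h2, h2]
    refine Finset.sum_congr rfl fun v hv => ?_
    rw [hφ _ hσx.1 v (Finset.mem_inter.1 hv).1, hφ _ hs v (Finset.mem_inter.1 hv).2]
  refine ⟨fun x => φ (σ x) x, fun x hx => ?_, fun s hs => ⟨φ s, key s hs⟩⟩
  obtain ⟨t, ht, hxt, hcard⟩ := hT.2 {x} hx
  rw [Finset.singleton_subset_iff] at hxt
  change φ (σ x) x = _
  rw [key t ⟨ht, hcard⟩ x (subset_convexHull ℝ _ hxt), hφ t ⟨ht, hcard⟩ x hxt]

lemma IsTriangulation.isFiniteElement_of_eqOn (hT : IsTriangulation T) {w : Space ν → ℝ → ℝ}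
    (hw : ∀ a ∈ controlGrid h, ∀ s ∈ cells T,
      ∃ φ : Space ν →ᵃ[ℝ] ℝ, Set.EqOn (fun x => w x a) φ (simplexOf s)) :
    IsFiniteElement T h w := by
  intro a ha
  constructor
  · have : Finite (cells T) := (hT.1.subset fun s hs => hs.1).to_subtype
    rw [hT.space_eq]
    refine (locallyFinite_of_finite _).continuousOn_iUnion
      (fun s => (isCompact_simplexOf _).isClosed) fun s => ?_
    obtain ⟨φ, hφ⟩ := hw a ha s s.2
    exact φ.continuous_of_finiteDimensional.continuousOn.congr hφ
  · intro s hs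
    obtain ⟨φ, hφ⟩ := hw a ha s hs
    refine ⟨φ.linear.toContinuousLinearMap, fun x hx => ?_⟩
    have h1 : HasFDerivAt (fun z => φ.linear.toContinuousLinearMap z + φ 0)
        φ.linear.toContinuousLinearMap x := (ContinuousLinearMap.hasFDerivAt _).add_const _
    refine h1.congr_of_eventuallyEq ?_
    filter_upwards [mem_interior_iff_mem_nhds.1 hx] with z hz
    refine (hφ hz).trans ?_
    rw [φ.decomp]
    simp

/-- A constant gradient on the connected interior gives an affine function there; continuity extends
this to the simplex, which lies in the closure of its interior. -/
lemma IsFiniteElement.exists_affine_eqOn {w : Space ν → ℝ → ℝ} (hw : IsFiniteElement T h w)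
    {a : ℝ} (ha : a ∈ controlGrid h) {s : Finset (Space ν)} (hs : s ∈ cells T)
    (hint : (interior (simplexOf s)).Nonempty) :
    ∃ φ : Space ν →ᵃ[ℝ] ℝ, Set.EqOn (fun x => w x a) φ (simplexOf s) := by
  obtain ⟨hcont, hgrad⟩ := hw a ha
  obtain ⟨p, hp⟩ := hgrad s hs
  obtain ⟨x₀, hx₀⟩ := hint
  have hconv : Convex ℝ (simplexOf s) := convex_convexHull ℝ _
  refine ⟨p.toLinearMap.toAffineMap + AffineMap.const ℝ _ (w x₀ a - p x₀), ?_⟩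
  have h1 : Set.EqOn (fun x => w x a) (fun x => p x + (w x₀ a - p x₀))
      (interior (simplexOf s)) := by
    have hd : ∀ x, HasFDerivAt (fun x => p x + (w x₀ a - p x₀)) p x := fun x =>
      p.hasFDerivAt.add_const _
    refine isOpen_interior.eqOn_of_fderiv_eq hconv.interior.isPreconnected
      (fun x hx => (hp x hx).differentiableAt.differentiableWithinAt)
      (fun x _ => (hd x).differentiableAt.differentiableWithinAt)
      (fun x hx => ?_) hx₀ (by simp)
    rw [(hp x hx).fderiv, (hd x).fderiv]
  have h2 : simplexOf s ⊆ closure (interior (simplexOf s)) := by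
    rw [hconv.closure_interior_eq_closure_of_nonempty_interior ⟨x₀, hx₀⟩]
    exact subset_closure
  have h3 := h1.of_subset_closure (hcont.mono (T.convexHull_subset_space hs.1))
    (by fun_prop) interior_subset h2
  intro x hx
  simpa using h3 hx

/-- The weights depend on `z` alone, so one pair `s`, `μ` serves all finite element functions; this
permits comparing two of them at `z`. -/
lemma IsTriangulation.exists_isInterpolated (hT : IsTriangulation T)
    (hint : ∀ s ∈ cells T, (interior (simplexOf s)).Nonempty)
    (hdiam : ∀ s ∈ cells T, Metric.diam (simplexOf s) ≤ k) {z : Space ν} (hz : z ∈ T.space) :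
    ∃ s μ, ∀ w, IsFiniteElement T h w → IsInterpolated T.vertices (controlGrid h) k w z s μ := by
  obtain ⟨s, hs, hzs⟩ := hT.exists_cell hz
  obtain ⟨μ, hμ0, hμ1, hμz⟩ := Finset.mem_convexHull'.1 hzs
  refine ⟨s, μ, fun w hw => ⟨subset_vertices hs, hμ0, hμ1, hμz, fun x hx => ?_, fun a ha => ?_⟩⟩
  · rw [← dist_eq_norm]
    exact (Metric.dist_le_diam_of_mem (isCompact_simplexOf s).isBounded
      (subset_convexHull ℝ _ hx) hzs).trans (hdiam s hs)
  · obtain ⟨φ, hφ⟩ := hw.exists_affine_eqOn ha hs (hint s hs)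
    have h1 := hφ hzs
    simp only at h1
    rw [h1, ← hμz, φ.map_sum_smul hμ1]
    refine Finset.sum_congr rfl fun x hx => ?_
    rw [← hφ (subset_convexHull ℝ _ hx)]

lemma IsInterpolated.abs_sub_le {V : Set (Space ν)} {G : Set ℝ} {w w' : Space ν → ℝ → ℝ}
    {z : Space ν} {s : Finset (Space ν)} {μ : Space ν → ℝ}
    (hz : IsInterpolated V G k w z s μ) (hz' : IsInterpolated V G k w' z s μ) {a D : ℝ}
    (ha : a ∈ G) (hD : ∀ x ∈ V, |w x a - w' x a| ≤ D) : |w z a - w' z a| ≤ D := by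
  rw [hz.apply_eq a ha, hz'.apply_eq a ha, ← Finset.sum_sub_distrib]
  calc _ ≤ ∑ x ∈ s, |μ x * w x a - μ x * w' x a| := Finset.abs_sum_le_sum_abs _ _
    _ ≤ ∑ x ∈ s, μ x * D := Finset.sum_le_sum fun x hx => by
        rw [← mul_sub, abs_mul, abs_of_nonneg (hz.nonneg x hx)]
        exact mul_le_mul_of_nonneg_left (hD x (hz.subset hx)) (hz.nonneg x hx)
    _ = D := by rw [← Finset.sum_mul, hz.sum_eq_one, one_mul]

lemma finite_controlGrid (h : ℝ) : (controlGrid h).Finite := by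
  refine ((Set.finite_Iic ⌊1 / h⌋₊).image fun i : ℕ => (i : ℝ) * h).subset ?_
  rintro a ⟨i, hi, rfl⟩
  exact ⟨i, Nat.le_floor hi, rfl⟩

lemma mem_controlGridFrom_self (hh : 0 < h) {a : ℝ} (ha : a ∈ controlGrid h) :
    a ∈ controlGridFrom h a := ⟨ha, le_rfl, (mem_Icc_of_mem_controlGrid hh ha).2⟩

lemma abs_sub_le_of_isLeast_image {ι : Type*} {B : Set ι} {F F' : ι → ℝ} {m m' D : ℝ}
    (hm : IsLeast (F '' B) m) (hm' : IsLeast (F' '' B) m') (hD : ∀ b ∈ B, |F b - F' b| ≤ D) :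
    |m - m'| ≤ D := by
  obtain ⟨b, hb, rfl⟩ := hm.1
  obtain ⟨b', hb', rfl⟩ := hm'.1
  have h1 := hm.2 ⟨b', hb', rfl⟩
  have h2 := hm'.2 ⟨b, hb, rfl⟩
  have h3 := abs_le.1 (hD b hb)
  have h4 := abs_le.1 (hD b' hb')
  rw [abs_le]
  constructor <;> linarith

/-! ### Contraction, existence, uniqueness and the a priori bound -/

section FixedPoint

variable {g : Space ν → ℝ → Space ν} {f : Space ν → ℝ → ℝ} {lam : ℝ}

lemma abs_stepOp_sub_le (hT : IsTriangulation T)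
    (hint : ∀ s ∈ cells T, (interior (simplexOf s)).Nonempty)
    (hinv : ∀ x ∈ T.space, ∀ a ∈ controlGrid h, x + h • g x a ∈ T.space)
    (hlh : lam * h ≤ 1) {w w' : Space ν → ℝ → ℝ} (hw : IsFiniteElement T h w)
    (hw' : IsFiniteElement T h w') {D : ℝ}
    (hD : ∀ x ∈ T.vertices, ∀ a ∈ controlGrid h, |w x a - w' x a| ≤ D)
    {x : Space ν} (hx : x ∈ T.vertices) {a b : ℝ} (ha : a ∈ controlGrid h)
    (hb : b ∈ controlGrid h) :
    |stepOp g f lam h b w x a - stepOp g f lam h b w' x a| ≤ (1 - lam * h) * D := by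
  obtain ⟨k, hk⟩ := hT.exists_diam_le
  obtain ⟨s, μ, hs⟩ := hT.exists_isInterpolated (h := h) hint hk
    (hinv x (T.vertices_subset_space hx) a ha)
  rw [stepOp, stepOp, add_sub_add_right_eq_sub, ← mul_sub, abs_mul,
    abs_of_nonneg (by linarith : 0 ≤ 1 - lam * h)]
  exact mul_le_mul_of_nonneg_left ((hs w hw).abs_sub_le (hs w' hw') hb fun x hx => hD x hx b hb)
    (by linarith)

theorem exists_isDiscreteSolution (hT : IsTriangulation T)
    (hint : ∀ s ∈ cells T, (interior (simplexOf s)).Nonempty)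
    (hinv : ∀ x ∈ T.space, ∀ a ∈ controlGrid h, x + h • g x a ∈ T.space)
    (hlam : 0 < lam) (hh : 0 < h) (hlh : lam * h ≤ 1) :
    ∃ w, IsDiscreteSolution g f lam h T w := by
  classical
  have : Fintype T.vertices := hT.finite_vertices.fintype
  have : Fintype (controlGrid h) := (finite_controlGrid h).fintype
  choose I hI hIaff using fun u => hT.exists_interpolant (T := T) u
  -- Nodal values form a finite-dimensional space, complete in the sup norm, on which Banach's
  -- theorem applies; the zeros are default values outside the grid.
  let ext (u : T.vertices → controlGrid h → ℝ) (x : Space ν) (a : ℝ) : ℝ :=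
    I (fun v => if hv : v ∈ T.vertices then
      if ha : a ∈ controlGrid h then u ⟨v, hv⟩ ⟨a, ha⟩ else 0 else 0) x
  have hext : ∀ u, ∀ x : T.vertices, ∀ a : controlGrid h, ext u x a = u x a := fun u x a => by
    simp only [ext]
    rw [hI _ _ x.2]
    simp
  have hfe : ∀ u, IsFiniteElement T h (ext u) := fun u =>
    hT.isFiniteElement_of_eqOn fun a _ s hs => hIaff _ s hs
  let Φ (u : T.vertices → controlGrid h → ℝ) (x : T.vertices) (a : controlGrid h) : ℝ :=
    sInf ((fun b => stepOp g f lam h b (ext u) x a) '' controlGridFrom h a)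
  have hΦ : ∀ u (x : T.vertices) (a : controlGrid h), IsLeast ((fun b => stepOp g f lam h b (ext u) x a) '' controlGridFrom h a)
      (Φ u x a) := fun u (x : T.vertices) (a : controlGrid h) => by
    have hfin := ((finite_controlGrid h).subset
      (Set.inter_subset_left : controlGridFrom h a ⊆ _)).image
      (fun b => stepOp g f lam h b (ext u) x a)
    exact ⟨Set.Nonempty.csInf_mem ⟨_, _, mem_controlGridFrom_self hh a.2, rfl⟩ hfin,
      fun _ hb => csInf_le hfin.bddBelow hb⟩
  have hcontr : ContractingWith (Real.toNNReal (1 - lam * h)) Φ := by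
    refine ⟨by rw [Real.toNNReal_lt_one]; nlinarith, LipschitzWith.of_dist_le_mul fun u u' => ?_⟩
    rw [Real.coe_toNNReal _ (by linarith)]
    have hr : 0 ≤ (1 - lam * h) * dist u u' := mul_nonneg (by linarith) dist_nonneg
    refine (dist_pi_le_iff hr).2 fun x => (dist_pi_le_iff hr).2 fun a => ?_
    rw [Real.dist_eq]
    refine abs_sub_le_of_isLeast_image (hΦ u x a) (hΦ u' x a) fun b hb =>
      abs_stepOp_sub_le hT hint hinv hlh (hfe u) (hfe u') (fun x hx a ha => ?_) x.2 a.2 hb.1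
    rw [hext u ⟨x, hx⟩ ⟨a, ha⟩, hext u' ⟨x, hx⟩ ⟨a, ha⟩, ← Real.dist_eq]
    exact (dist_le_pi_dist (u _) (u' _) _).trans (dist_le_pi_dist u u' _)
  have hfix := hcontr.fixedPoint_isFixedPt
  refine ⟨ext (ContractingWith.fixedPoint Φ hcontr), hfe _, fun x hx a ha => ?_⟩
  have h1 := hΦ (ContractingWith.fixedPoint Φ hcontr) ⟨x, hx⟩ ⟨a, ha⟩
  rw [hfix] at h1
  rwa [hext _ ⟨x, hx⟩ ⟨a, ha⟩]

theorem IsDiscreteSolution.eqOn (hT : IsTriangulation T)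
    (hint : ∀ s ∈ cells T, (interior (simplexOf s)).Nonempty)
    (hinv : ∀ x ∈ T.space, ∀ a ∈ controlGrid h, x + h • g x a ∈ T.space)
    (hlam : 0 < lam) (hh : 0 < h) (hlh : lam * h ≤ 1) {w w' : Space ν → ℝ → ℝ}
    (hw : IsDiscreteSolution g f lam h T w) (hw' : IsDiscreteSolution g f lam h T w') :
    ∀ x ∈ T.space, ∀ a ∈ controlGrid h, w x a = w' x a := by
  have hnodes : ∀ x ∈ T.vertices, ∀ a ∈ controlGrid h, |w x a - w' x a| ≤ 0 := by
    intro x hx a ha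
    -- The maximal nodal difference `D` satisfies `D ≤ (1 - λh) D`, hence `D ≤ 0`.
    obtain ⟨⟨x₀, a₀⟩, h₀, hmax⟩ := Set.exists_max_image (T.vertices ×ˢ controlGrid h)
      (fun p => |w p.1 p.2 - w' p.1 p.2|) (hT.finite_vertices.prod (finite_controlGrid h))
      ⟨(x, a), hx, ha⟩
    have h1 := abs_sub_le_of_isLeast_image (hw.2 x₀ h₀.1 a₀ h₀.2) (hw'.2 x₀ h₀.1 a₀ h₀.2)
      fun b hb => abs_stepOp_sub_le hT hint hinv hlh hw.1 hw'.1
        (fun x hx a ha => hmax (x, a) ⟨hx, ha⟩) h₀.1 h₀.2 hb.1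
    have h2 := hmax (x, a) ⟨hx, ha⟩
    simp only at h1 h2
    nlinarith [mul_pos hlam hh]
  intro x hx a ha
  obtain ⟨k, hk⟩ := hT.exists_diam_le
  obtain ⟨s, μ, hs⟩ := hT.exists_isInterpolated (h := h) hint hk hx
  have := (hs w hw.1).abs_sub_le (hs w' hw'.1) ha fun x hx => hnodes x hx a ha
  exact sub_eq_zero.1 (abs_nonpos_iff.1 this)

theorem IsDiscreteSolution.isNodalSolution {Ω : Set (Space ν)} {Lf Mf : ℝ}
    (hT : IsTriangulation T)
    (hint : ∀ s ∈ cells T, (interior (simplexOf s)).Nonempty)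
    (hdiam : ∀ s ∈ cells T, Metric.diam (simplexOf s) ≤ k)
    (hinv : ∀ x ∈ T.space, ∀ a ∈ controlGrid h, x + h • g x a ∈ T.space)
    (hsub : T.space ⊆ Ω) (hf : IsBoundedLipschitz Ω f Lf Mf)
    (hlam : 0 < lam) (hh : 0 < h) (hlh : lam * h ≤ 1) {w : Space ν → ℝ → ℝ}
    (hw : IsDiscreteSolution g f lam h T w) :
    IsNodalSolution Ω g f lam h k (Mf / lam) T.space T.vertices w := by
  refine ⟨hsub, T.vertices_subset_space, hinv, fun z hz => ?_, hw.2, fun x hx a ha => ?_⟩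
  · obtain ⟨s, μ, hs⟩ := hT.exists_isInterpolated (h := h) hint hdiam hz
    exact ⟨s, μ, hs w hw.1⟩
  · obtain ⟨⟨x₀, a₀⟩, ⟨hx₀, ha₀⟩, hmax⟩ := Set.exists_max_image (T.vertices ×ˢ controlGrid h)
      (fun p => |w p.1 p.2|) (hT.finite_vertices.prod (finite_controlGrid h)) ⟨(x, a), hx, ha⟩
    simp only at hx₀ ha₀
    refine (hmax (x, a) ⟨hx, ha⟩).trans ?_
    obtain ⟨b, hb, hwb⟩ := (hw.2 x₀ hx₀ a₀ ha₀).1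
    have hx₀' := T.vertices_subset_space hx₀
    obtain ⟨s, μ, hs⟩ := hT.exists_isInterpolated (h := h) hint hdiam (hinv x₀ hx₀' a₀ ha₀)
    -- Comparison with zero bounds `|w|` at the Euler point by the nodal maximum `D`; then `D ≤ (1 -
    -- λh) D + h Mf`.
    have hzero : IsFiniteElement T h (fun _ _ => 0) := hT.isFiniteElement_of_eqOn
      fun a _ s _ => ⟨AffineMap.const ℝ _ 0, fun x _ => by simp⟩
    have h1 := (hs w hw.1).abs_sub_le (hs _ hzero) hb.1 (D := |w x₀ a₀|) fun x hx => by
      simpa using hmax (x, b) ⟨hx, hb.1⟩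
    have h2 := hf.2 x₀ (hsub hx₀') a₀ (mem_Icc_of_mem_controlGrid hh ha₀)
    rw [Real.norm_eq_abs] at h2
    simp only [sub_zero] at h1
    have h3 : |w x₀ a₀| ≤ (1 - lam * h) * |w x₀ a₀| + h * Mf := by
      conv_lhs => rw [← hwb]
      simp only [stepOp]
      refine (abs_add_le _ _).trans ?_
      rw [abs_mul, abs_mul, abs_of_pos hh, abs_of_nonneg (by linarith : 0 ≤ 1 - lam * h)]
      exact add_le_add (mul_le_mul_of_nonneg_left h1 (by linarith))
        (mul_le_mul_of_nonneg_left h2 hh.le)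
    rw [le_div_iff₀ hlam]
    have h4 : h * (|w x₀ a₀| * lam) ≤ h * Mf := by linarith
    exact le_of_mul_le_mul_left h4 hh

end FixedPoint

end MonotoneControl

namespace MonotoneControl

/-! ### Continuous and grid controls -/

variable {ν : ℕ} {Ω S V : Set (Space ν)} {g : Space ν → ℝ → Space ν}
  {f : Space ν → ℝ → ℝ} {w : Space ν → ℝ → ℝ} {lam Lg Mg Lf Mf h k : ℝ}

lemma IsControl.mono {a b : ℝ} {α : ℝ → ℝ} (hα : IsControl a α) (hb : b ≤ a) : IsControl b α :=
  ⟨hα.1, hα.2.1, hb.trans hα.2.2⟩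

/-- A grid control as a left continuous step function of time. -/
lemma IsGridControl.exists_isControl (hh : 0 < h) {a : ℝ} {c : ℕ → ℝ}
    (hc : IsGridControl h a c) : ∃ α, IsControl a α ∧
      ∀ (m : ℕ) (s : ℝ), m * h < s → s ≤ (m + 1) * h → α s = c m := by
  -- At `s = 0` truncated subtraction gives index `0`, so the control starts at `c 0 = a`.
  refine ⟨fun s => c (⌈s / h⌉₊ - 1), ⟨fun s _ t _ hst => hc.2.1 ?_,
    fun s _ => mem_Icc_of_mem_controlGrid hh (hc.2.2 _), by simp [hc.1]⟩, fun m s h1 h2 => ?_⟩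
  · have : ⌈s / h⌉₊ ≤ ⌈t / h⌉₊ := Nat.ceil_mono (by gcongr)
    omega
  · have : ⌈s / h⌉₊ = m + 1 := by
      rw [Nat.ceil_eq_iff (by omega)]
      constructor
      · rw [lt_div_iff₀ hh]; simpa using h1
      · rw [div_le_iff₀ hh]; push_cast; exact h2
    simp [this]

lemma IsControl.exists_isGridControl (hh : 0 < h) {a : ℝ} (ha : a ∈ controlGrid h)
    {α : ℝ → ℝ} (hα : IsControl a α) : ∃ (c : ℕ → ℝ) (Δ : ℕ → ℝ), IsGridControl h a c ∧
      (∀ m, 0 ≤ Δ m) ∧ (∀ n, ∑ m ∈ Finset.range n, Δ m ≤ 2) ∧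
      ∀ (m : ℕ) (s : ℝ), m * h < s → s ≤ (m + 1) * h → |α s - c m| ≤ Δ m + h := by
  have hmono : ∀ s t, 0 ≤ s → s ≤ t → α s ≤ α t := fun s t hs hst => hα.1 hs (hs.trans hst) hst
  have hmh : ∀ m : ℕ, 0 ≤ m * h := fun m => by positivity
  have hstep : ∀ m : ℕ, α (m * h) ≤ α ((m + 1 : ℕ) * h) := fun m =>
    hmono _ _ (hmh m) (by gcongr; simp)
  have haI := mem_Icc_of_mem_controlGrid hh ha
  -- The start is forced to be `a`, though `α 0` may be much larger; the extra `1` in `Δ 0` pays for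
  -- that. Later values are rounded down, at a cost of at most `h`, and the increments of `α`
  -- telescope to at most `1`.
  refine ⟨fun m => if m = 0 then a else ⌊α (m * h) / h⌋₊ * h,
    fun m => (α ((m + 1 : ℕ) * h) - α (m * h)) + if m = 0 then 1 else 0,
    ⟨rfl, monotone_nat_of_le_succ fun m => ?_, fun m => ?_⟩, fun m => ?_, fun n => ?_,
    fun m s h1 h2 => ?_⟩
  · rcases Nat.eq_zero_or_pos m with rfl | hm
    · obtain ⟨i, hi, rfl⟩ := ha
      simp only [if_true, Nat.succ_ne_zero, if_false]
      gcongr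
      refine Nat.le_floor ?_
      rw [le_div_iff₀ hh]
      exact hα.2.2.trans (hmono _ _ le_rfl (hmh _))
    · simp only [hm.ne', Nat.succ_ne_zero, if_false]
      have := Nat.floor_mono (div_le_div_of_nonneg_right (hstep m) hh.le)
      gcongr
  · dsimp only
    split_ifs with hm
    · exact ha
    · refine ⟨_, (Nat.floor_le (div_nonneg (hα.2.1 _ (hmh m)).1 hh.le)).trans ?_, rfl⟩
      gcongr
      exact (hα.2.1 _ (hmh m)).2
  · have := hstep m
    dsimp only
    split_ifs <;> linarith
  · rw [Finset.sum_add_distrib, Finset.sum_range_sub (fun m : ℕ => α (m * h))]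
    have h1 := (hα.2.1 _ (hmh n)).2
    have h2 := (hα.2.1 _ (hmh 0)).1
    have h3 : ∑ m ∈ Finset.range n, (if m = 0 then (1 : ℝ) else 0) ≤ 1 := by
      rw [Finset.sum_ite_eq']
      split_ifs <;> norm_num
    linarith
  · have hs0 := (hmh m).trans h1.le
    have hs1 := hmono _ _ (hmh m) h1.le
    have hs2 := hmono s ((m + 1 : ℕ) * h) hs0 (by push_cast; exact h2)
    dsimp only
    split_ifs with hm
    · subst hm
      have h3 := hα.2.2.trans (hmono 0 s le_rfl hs0)
      have h4 := (hα.2.1 s hs0).2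
      have h5 := hstep 0
      rw [abs_of_nonneg (by linarith)]
      linarith [haI.1]
    · have h3 := Nat.floor_le (div_nonneg (hα.2.1 _ (hmh m)).1 hh.le)
      have h4 := Nat.lt_floor_add_one (α (m * h) / h)
      rw [le_div_iff₀ hh] at h3
      rw [div_lt_iff₀ hh] at h4
      rw [abs_of_nonneg (by linarith)]
      linarith

/-! ### Error estimates -/

/-- Error bound for a finite horizon of `n` steps. -/
theorem IsNodalSolution.abs_valueFunction_sub_le (hlam : 0 < lam) (hLg : 0 < Lg)
    (hMg : 0 < Mg) (hLf : 0 < Lf) (hMf : 0 < Mf)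
    (hg : IsBoundedLipschitz Ω g Lg Mg) (hf : IsBoundedLipschitz Ω f Lf Mf)
    (hstay : ∀ x ∈ Ω, ∀ α, IsControl 0 α → ∃ y, IsTrajectory Ω g x α y)
    (hh : 0 < h) (hh1 : h ≤ 1) (hlh : lam * h < 1) (hk : 0 ≤ k)
    (hw : IsNodalSolution Ω g f lam h k (Mf / lam) S V w) {x : Space ν} (hx : x ∈ S)
    {a : ℝ} (ha : a ∈ controlGrid h) (n : ℕ) :
    |valueFunction Ω g f lam x a - w x a| ≤
      growth lam Lg Lf h n * ((√(1 / (2 * Lg) + 1) + Mg + 1 + 2 * Lg) * (h + k / √h)) +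
        2 * (Lf + Mf) * h + (1 - lam * h) ^ n * (2 * (Mf / lam)) := by
  have hsh : 0 < √h := Real.sqrt_pos.2 hh
  have hA := growth_nonneg (lam := lam) hLg.le hLf.le hh.le hlh.le n
  have haI := mem_Icc_of_mem_controlGrid hh ha
  -- This fixes `δ = k / √(2 Lg h)`, the source of the rate `k/√h`.
  have hδ : k ^ 2 = 2 * Lg * h * (k / √(2 * Lg * h)) ^ 2 := by
    rw [div_pow, Real.sq_sqrt (by positivity)]; field_simp
  have hsqrt : √((k / √(2 * Lg * h)) ^ 2 + k ^ 2) ≤ √(1 / (2 * Lg) + 1) * (k / √h) := by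
    rw [← Real.sqrt_sq (by positivity : 0 ≤ k / √h), ← Real.sqrt_mul (by positivity)]
    refine Real.sqrt_le_sqrt ?_
    rw [div_pow, div_pow, Real.sq_sqrt (by positivity), Real.sq_sqrt hh.le, add_mul, one_mul]
    refine add_le_add (le_of_eq (by field_simp)) ?_
    rw [le_div_iff₀ hh]
    nlinarith [sq_nonneg k]
  -- Here `σ` is the total of the rounding increments: at most `2` when a control is rounded to the
  -- grid, and `0` when a grid control is used as a step function.
  have hcombine : ∀ σ : ℝ, σ ≤ 2 →
      growth lam Lg Lf h n * √((k / √(2 * Lg * h)) ^ 2 + k ^ 2) +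
        (growth lam Lg Lf h n * (‖x - x‖ + (Mg + 1) * h + Lg * h * σ) + Lf * h * σ) ≤
      growth lam Lg Lf h n * ((√(1 / (2 * Lg) + 1) + Mg + 1 + 2 * Lg) * (h + k / √h)) +
        2 * Lf * h := by
    intro σ hσ
    have h1 : √((k / √(2 * Lg * h)) ^ 2 + k ^ 2) + (‖x - x‖ + (Mg + 1) * h + Lg * h * σ) ≤
        (√(1 / (2 * Lg) + 1) + Mg + 1 + 2 * Lg) * (h + k / √h) := by
      have h2 : Lg * h * σ ≤ Lg * h * 2 := by gcongr
      have h3 : 0 ≤ √(1 / (2 * Lg) + 1) * h := by positivity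
      have h4 : 0 ≤ (Mg + 1 + 2 * Lg) * (k / √h) := by positivity
      rw [sub_self, norm_zero]
      linarith
    have h2 := mul_le_mul_of_nonneg_left h1 hA
    have h3 : Lf * h * σ ≤ Lf * h * 2 := by gcongr
    linarith
  have hbdd : BddBelow {J : ℝ | ∃ α y, IsControl a α ∧ IsTrajectory Ω g x α y ∧
      J = cost f lam α y} := by
    refine ⟨-(Mf / lam), ?_⟩
    rintro J ⟨α, y, hα, hy, rfl⟩
    exact (abs_le.1 (abs_cost_le hlam hf (hα.mono haI.1) hy)).1
  rw [abs_le]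
  constructor
  · have hle : w x a - (growth lam Lg Lf h n *
        ((√(1 / (2 * Lg) + 1) + Mg + 1 + 2 * Lg) * (h + k / √h)) +
        2 * (Lf + Mf) * h + (1 - lam * h) ^ n * (2 * (Mf / lam))) ≤
        valueFunction Ω g f lam x a := by
      refine le_csInf ?_ ?_
      · have hconst : IsControl a fun _ => a := ⟨fun _ _ _ _ _ => le_rfl, fun _ _ => haI, le_rfl⟩
        obtain ⟨y, hy⟩ := hstay x (hw.subset hx) _ (hconst.mono haI.1)
        exact ⟨_, _, y, hconst, hy, rfl⟩
      · rintro J ⟨α, y, hα, hy, rfl⟩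
        obtain ⟨c, Δ, hc, hΔ, hsum, hαc⟩ := hα.exists_isGridControl hh ha
        have h1 := (abs_le.1 (abs_eulerCost_sub_cost_le hlam hLg hMg hLf hMf hg hf hh hlh.le
          hw.subset hw.invariant n x c α x y Δ hx hc.2.2 (hα.mono haI.1) hy hΔ hαc)).2
        have h2 := hw.le_eulerCost_add hLg hLf hg hf hh hlh.le hδ n hc hx
        have h3 := hcombine _ (hsum n)
        linarith
    linarith
  · have hv := hw.le_add hLg hLf hg hf hh hlh hδ n ha hx
      (v := valueFunction Ω g f lam x a - (growth lam Lg Lf h n *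
        (‖x - x‖ + (Mg + 1) * h + Lg * h * 0) + Lf * h * 0 + 2 * Mf * h +
          (1 - lam * h) ^ n * (Mf / lam))) fun c hc => by
      obtain ⟨α, hα, hαc⟩ := hc.exists_isControl hh
      obtain ⟨y, hy⟩ := hstay x (hw.subset hx) _ (hα.mono haI.1)
      have h1 : valueFunction Ω g f lam x a ≤ cost f lam α y :=
        csInf_le hbdd ⟨α, y, hα, hy, rfl⟩
      have h2 := (abs_le.1 (abs_eulerCost_sub_cost_le hlam hLg hMg hLf hMf hg hf hh hlh.le
        hw.subset hw.invariant n x c α x y (fun _ => 0) hx hc.2.2 (hα.mono haI.1) hy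
        (fun _ => le_rfl) fun m s hs1 hs2 => by simp [hαc m s hs1 hs2, hh.le])).1
      rw [Finset.sum_const_zero] at h2
      linarith
    have h3 := hcombine 0 zero_le_two
    linarith

/-! ### Choice of the horizon and the final rate -/

lemma exists_horizon_of_lt {L b : ℝ} (hlam : 0 < lam) (hL : 0 < L) (hb : 0 ≤ b)
    (hlt : L < lam) (hh : 0 < h) (hlh : lam * h < 1) :
    ∃ n : ℕ, (1 - lam * h) ^ n ≤ h ∧ growth lam L b h n ≤ b / (lam - L) := by
  obtain ⟨n, hn⟩ := exists_pow_lt_of_lt_one hh (by nlinarith : 1 - lam * h < 1)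
  exact ⟨n, hn.le, growth_le_of_lt hL.le hb hh.le hlam.le hlt hlh.le n⟩

lemma exists_horizon_of_gt {L b e : ℝ} (hlam : 0 < lam) (hb : 0 ≤ b)
    (hlt : lam < L) (hh : 0 < h) (hh1 : h ≤ 1) (hlh : lam * h < 1) (he : 0 < e) :
    ∃ n : ℕ, (1 - lam * h) ^ n ≤ e ^ (lam / L) ∧
      growth lam L b h n * e ≤ b / (L - lam) * Real.exp (L - lam) * e ^ (lam / L) := by
  have hL : 0 < L := hlam.trans hlt
  have hpos : 0 < L - lam := by linarith
  rcases le_total 1 e with h1 | h1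
  · refine ⟨0, ?_, ?_⟩
    · simpa using Real.one_le_rpow h1 (by positivity)
    · simp only [growth, zero_mul]; positivity
  -- This time balances the tail `exp(-λt)` with the accumulated error `e · exp((L - λ)t)`; both
  -- equal `e^(λ/L)`. Rounding `t` up to a multiple of `h ≤ 1` costs the factor `exp(L - λ)`.
  set t := -Real.log e / L with ht
  have ht0 : 0 ≤ t := div_nonneg (neg_nonneg.2 (Real.log_nonpos he.le h1)) hL.le
  have hlog : Real.log e = -(L * t) := by rw [ht]; field_simp
  have hpow : e ^ (lam / L) = Real.exp (-(lam * t)) := by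
    rw [Real.rpow_def_of_pos he, hlog]; congr 1; field_simp
  have hn1 : t ≤ ⌈t / h⌉₊ * h := (div_le_iff₀ hh).1 (Nat.le_ceil _)
  have hn2 : ⌈t / h⌉₊ * h ≤ t + h := by
    have := (Nat.ceil_lt_add_one (div_nonneg ht0 hh.le)).le
    calc _ ≤ (t / h + 1) * h := by gcongr
      _ = _ := by field_simp
  refine ⟨⌈t / h⌉₊, ?_, ?_⟩
  · have h2 : 1 - lam * h ≤ Real.exp (-(lam * h)) := by
      linarith [Real.add_one_le_exp (-(lam * h))]
    refine (pow_le_pow_left₀ (by linarith) h2 _).trans ?_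
    rw [← Real.exp_nat_mul, hpow]
    refine Real.exp_le_exp.2 ?_
    nlinarith
  · have h2 := growth_le_of_gt hL.le hb hh.le hlam.le hlt hlh.le ⌈t / h⌉₊
    have h3 : Real.exp ((L - lam) * (⌈t / h⌉₊ * h)) ≤
        Real.exp (L - lam) * Real.exp ((L - lam) * t) := by
      rw [← Real.exp_add]
      refine Real.exp_le_exp.2 ?_
      nlinarith
    have h4 : Real.exp ((L - lam) * t) * e = e ^ (lam / L) := by
      rw [hpow]
      conv_lhs => rw [← Real.exp_log he, hlog]
      rw [← Real.exp_add]
      congr 1; ring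
    calc _ ≤ b / (L - lam) * (Real.exp (L - lam) * Real.exp ((L - lam) * t)) * e := by
          gcongr
          exact h2.trans (by gcongr)
      _ = b / (L - lam) * Real.exp (L - lam) * (Real.exp ((L - lam) * t) * e) := by ring
      _ = _ := by rw [h4]

lemma IsBoundedLipschitz.mono {F : Type*} [NormedAddCommGroup F] {φ : Space ν → ℝ → F}
    {L L' C : ℝ} (hφ : IsBoundedLipschitz Ω φ L C) (hL : L ≤ L') : IsBoundedLipschitz Ω φ L' C :=
  ⟨fun x hx x' hx' a ha a' ha' => (hφ.1 x hx x' hx' a ha a' ha').trans (by gcongr), hφ.2⟩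

/-- The error bound with a constant depending only on the data. -/
theorem exists_forall_abs_valueFunction_sub_le (ν : ℕ) {Ω : Set (Space ν)}
    {g : Space ν → ℝ → Space ν} {f : Space ν → ℝ → ℝ} {γ : ℝ}
    (hlam : 0 < lam) (hLg : 0 < Lg) (hMg : 0 < Mg) (hLf : 0 < Lf) (hMf : 0 < Mf)
    (hg : IsBoundedLipschitz Ω g Lg Mg) (hf : IsBoundedLipschitz Ω f Lf Mf)
    (hstay : ∀ x ∈ Ω, ∀ α, IsControl 0 α → ∃ y, IsTrajectory Ω g x α y)
    (hγ : (Lg < lam ∧ γ = 1) ∨ (lam < Lg ∧ γ = lam / Lg) ∨ (Lg = lam ∧ 0 < γ ∧ γ < 1)) :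
    ∃ M : ℝ, ∀ (h k : ℝ) (S V : Set (Space ν)) (w : Space ν → ℝ → ℝ), 0 < h → h ≤ 1 →
      lam * h < 1 → 0 ≤ k → IsNodalSolution Ω g f lam h k (Mf / lam) S V w →
      ∀ x ∈ S, ∀ a ∈ controlGrid h,
        |valueFunction Ω g f lam x a - w x a| ≤ M * (h + k / √h) ^ γ := by
  have hgt : ∀ L, lam < L → IsBoundedLipschitz Ω g L Mg →
      ∃ M : ℝ, ∀ (h k : ℝ) (S V : Set (Space ν)) (w : Space ν → ℝ → ℝ), 0 < h → h ≤ 1 →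
      lam * h < 1 → 0 ≤ k → IsNodalSolution Ω g f lam h k (Mf / lam) S V w →
      ∀ x ∈ S, ∀ a ∈ controlGrid h,
        |valueFunction Ω g f lam x a - w x a| ≤ M * (h + k / √h) ^ (lam / L) := by
    intro L hL hgL
    have hL0 := hlam.trans hL
    refine ⟨Lf / (L - lam) * Real.exp (L - lam) * (√(1 / (2 * L) + 1) + Mg + 1 + 2 * L) +
      2 * (Lf + Mf) + 2 * (Mf / lam), fun h k S V w hh hh1 hlh hk hw x hx a ha => ?_⟩
    have hsh : 0 < √h := Real.sqrt_pos.2 hh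
    have he : 0 < h + k / √h := by positivity
    obtain ⟨n, hn1, hn2⟩ := exists_horizon_of_gt hlam hLf.le hL hh hh1 hlh he
    have h1 := hw.abs_valueFunction_sub_le hlam hL0 hMg hLf hMf hgL hf hstay hh hh1 hlh hk hx ha n
    have h2 : h ≤ (h + k / √h) ^ (lam / L) := by
      have hle : lam / L ≤ 1 := (div_le_one hL0).2 hL.le
      calc h = h ^ (1 : ℝ) := (Real.rpow_one h).symm
        _ ≤ h ^ (lam / L) := Real.rpow_le_rpow_of_exponent_ge hh hh1 hle
        _ ≤ _ := Real.rpow_le_rpow hh.le (by linarith [div_nonneg hk hsh.le]) (by positivity)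
    have hK : 0 ≤ √(1 / (2 * L) + 1) + Mg + 1 + 2 * L := by positivity
    have h3 := mul_le_mul_of_nonneg_right hn2 hK
    have h4 := mul_le_mul_of_nonneg_left h2 (by positivity : 0 ≤ 2 * (Lf + Mf))
    have h5 := mul_le_mul_of_nonneg_right hn1 (by positivity : 0 ≤ 2 * (Mf / lam))
    linarith
  rcases hγ with ⟨hlt, rfl⟩ | ⟨hlt, rfl⟩ | ⟨heq, hγ0, hγ1⟩
  · have hpos : 0 < lam - Lg := by linarith
    refine ⟨Lf / (lam - Lg) * (√(1 / (2 * Lg) + 1) + Mg + 1 + 2 * Lg) +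
      2 * (Lf + Mf) + 2 * (Mf / lam), fun h k S V w hh hh1 hlh hk hw x hx a ha => ?_⟩
    have hsh : 0 < √h := Real.sqrt_pos.2 hh
    obtain ⟨n, hn1, hn2⟩ := exists_horizon_of_lt hlam hLg hLf.le hlt hh hlh
    have h1 := hw.abs_valueFunction_sub_le hlam hLg hMg hLf hMf hg hf hstay hh hh1 hlh hk hx ha n
    have h2 : h ≤ h + k / √h := by linarith [div_nonneg hk hsh.le]
    have h3 := mul_le_mul_of_nonneg_right hn2
      (by positivity : 0 ≤ (√(1 / (2 * Lg) + 1) + Mg + 1 + 2 * Lg) * (h + k / √h))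
    have h4 := mul_le_mul_of_nonneg_left h2 (by positivity : 0 ≤ 2 * (Lf + Mf))
    have h5 := mul_le_mul_of_nonneg_right (hn1.trans h2) (by positivity : 0 ≤ 2 * (Mf / lam))
    rw [Real.rpow_one]
    linarith
  · exact hgt Lg hlt hg
  -- A Lipschitz constant may be enlarged: with `L = λ/γ` the supercritical case yields exactly the
  -- exponent `γ`.
  · have hL : lam < lam / γ := by rw [lt_div_iff₀ hγ0]; nlinarith
    have := hgt (lam / γ) hL (hg.mono (heq ▸ hL.le))
    rwa [div_div_cancel₀ hlam.ne'] at this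

end MonotoneControl

theorem theorem3p1 (ν : ℕ) (Ω : Set (MonotoneControl.Space ν)) (hΩ : IsOpen Ω)
    (g : MonotoneControl.Space ν → ℝ → MonotoneControl.Space ν)
    (f : MonotoneControl.Space ν → ℝ → ℝ)
    (lam Lg Mg Lf Mf χ₁ C₅ γ : ℝ)
    (hlam : 0 < lam) (hLg : 0 < Lg) (hMg : 0 < Mg) (hLf : 0 < Lf) (hMf : 0 < Mf)
    (hχ₁ : 0 < χ₁)
    (hg : MonotoneControl.IsBoundedLipschitz Ω g Lg Mg)
    (hf : MonotoneControl.IsBoundedLipschitz Ω f Lf Mf)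
    -- the evolution of the system stays in `Ω`, whatever control is used
    (hstay : ∀ x ∈ Ω, ∀ α, MonotoneControl.IsControl 0 α →
      ∃ y, MonotoneControl.IsTrajectory Ω g x α y)
    (hγ : (Lg < lam ∧ γ = 1) ∨ (lam < Lg ∧ γ = lam / Lg) ∨ (Lg = lam ∧ 0 < γ ∧ γ < 1)) :
    ∃ M : ℝ, ∀ (Ks : Set ℝ) (T : ℝ → Geometry.SimplicialComplex ℝ (MonotoneControl.Space ν))
      (h₀ : ℝ → ℝ), MonotoneControl.IsTriangulationFamily Ω g χ₁ C₅ Ks T h₀ →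
      ∀ k ∈ Ks, ∀ h, MonotoneControl.IsStep h → h < h₀ k → h < 1 / lam →
        ∃ w, MonotoneControl.IsDiscreteSolution g f lam h (T k) w ∧
          (∀ w', MonotoneControl.IsDiscreteSolution g f lam h (T k) w' →
            ∀ x ∈ (T k).space, ∀ a ∈ MonotoneControl.controlGrid h, w' x a = w x a) ∧
          ∀ x ∈ (T k).space, ∀ a ∈ MonotoneControl.controlGrid h,
            |MonotoneControl.valueFunction Ω g f lam x a - w x a|
              ≤ M * (h + k / Real.sqrt h) ^ γ := by
  obtain ⟨M, hM⟩ := MonotoneControl.exists_forall_abs_valueFunction_sub_le ν hlam hLg hMg hLf hMf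
    hg hf hstay hγ
  refine ⟨M, fun Ks T h₀ hT k hk h hstep hh₀ hhlam => ?_⟩
  have hh : 0 < h := by
    obtain ⟨n, hn, rfl⟩ := hstep
    positivity
  have hh1 : h ≤ 1 := by
    obtain ⟨n, hn, rfl⟩ := hstep
    exact div_le_one_of_le₀ (by exact_mod_cast hn) (by positivity)
  have hlh : lam * h < 1 := by rwa [lt_div_iff₀ hlam, mul_comm] at hhlam
  have hTk := hT.triangulation k hk
  have hinv := hT.invariant k hk h hstep hh₀
  have hint : ∀ s ∈ MonotoneControl.cells (T k),
      (interior (MonotoneControl.simplexOf s)).Nonempty := fun s hs => by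
    obtain ⟨c, r, hr, -, hsub⟩ := hT.inner_ball k hk s hs
    exact ⟨c, hsub (Metric.mem_closedBall_self hr.le)⟩
  have hdiam : ∀ s ∈ MonotoneControl.cells (T k),
      Metric.diam (MonotoneControl.simplexOf s) ≤ k := fun s hs =>
    (hT.max_diam k hk).2 ⟨s, hs, rfl⟩
  obtain ⟨w, hw⟩ := MonotoneControl.exists_isDiscreteSolution (f := f) hTk hint hinv hlam hh hlh.le
  exact ⟨w, hw, fun w' hw' => hw'.eqOn hTk hint hinv hlam hh hlh.le hw,
    hM h k _ _ w hh hh1 hlh (hT.pos k hk).le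
      (hw.isNodalSolution hTk hint hdiam hinv (hT.subset k hk) hf hlam hh hlh.le)⟩
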